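/- \textbf{Setting.} Let $q\in(-1,1)$ and let $\nu$ be a probability measure on $\mathbb R$ with compact support. Let $\mathcal H=L^2(\mathbb R_+\times\mathbb R,\,dt\otimes\nu)$ (complex-valued functions, inner product linear in the second variable). On the algebraic Fock space $\mathcal F_{\mathrm{alg}}(\mathcal H)=\bigoplus_{n\ge0}\mathcal H^{\otimes n}$ with vacuum vector $\Omega$ take the positive definite $q$-inner product $$\langle \xi_1\otimes\dots\otimes\xi_n,\eta_1\otimes\dots\otimes\eta_m\rangle_q=\delta_{nm}\sum_{\sigma\in S_n}q^{i(\sigma)}\prod_{j=1}^n\langle\xi_j,\eta_{\sigma(j)}\rangle ,$$ where $i(\sigma)$ is the number of inversions of $\sigma$. For $\zeta\in\mathcal H$ and a bounded operator $T$ on $\mathcal H$ let $p(\zeta,T)=a(\zeta)+a^*(\zeta)+p(T)$, where $a^*(\zeta)(\eta_1\otimes\dots\otimes\eta_n)=\zeta\otimes\eta_1\otimes\dots\otimes\eta_n$, $a(\zeta)(\eta_1\otimes\dots\otimes\eta_n)=\sum_k q^{k-1}\langle\zeta,\eta_k\rangle\,\eta_1\otimes\dots\check\eta_k\dots\otimes\eta_n$,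 $p(T)(\eta_1\otimes\dots\otimes\eta_n)=\sum_k q^{k-1}(T\eta_k)\otimes\eta_1\otimes\dots\check\eta_k\dots\otimes\eta_n$ (the check marks an omitted factor), and $a(\zeta)\Omega=p(T)\Omega=0$. Consider real polynomials $f$ without constant term in noncommuting indeterminates $x_I$, indexed by the intervals $I=[a,b)\subset\mathbb R_+$. Let $f\mapsto\xi_f\in\mathcal H$ and $f\mapsto T_f$ be the real-linear maps for which, for $f=x_{I_1}\cdots x_{I_n}$, $\xi_f$ is the function $\mathbf 1_{I_1\cap\dots\cap I_n}(t)\,x^{n-1}$ and $T_f$ is multiplication by $\mathbf 1_{I_1\cap\dots\cap I_n}(t)\,x^{n}$. Put $X(f)=p(\xi_f,T_f)$, $Y_k(I)=X(x_I^k)$, $X(I)=Y_1(I)$ and $Y_k(t)=Y_k([0,t))$. Let $\mathcal A=\mathcal A^{\mathrm{alg}}_{X,\Delta}$ be the complex unital algebra generated by all $X(f)$, and $\mathcal A(t)$ the subalgebra generated by the $Y_k(s)$ with $k\ge1$, $s\le t$. Let $L^2(\varphi)$ be the completion of $\mathcal A$ for $\langle A,B\rangle_\varphi=\langle A\Omega,B\Omega\rangle_q$.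 The Wick products $W(\xi_{f_1}\otimes\dots\otimes\xi_{f_n})\in\mathcal A$ are defined by $W(\Omega)=\mathrm{Id}$ and $$W(\xi_{f_0}\otimes\dots\otimes\xi_{f_n})=X(f_0)W(\xi_{f_1}\otimes\dots\otimes\xi_{f_n})-\sum_{i=1}^nq^{i-1}\langle\xi_{f_0},\xi_{f_i}\rangle W(\xi_{f_1}\otimes\dots\check\xi_{f_i}\dots\otimes\xi_{f_n})-\sum_{i=1}^nq^{i-1}W(\xi_{f_0f_i}\otimes\xi_{f_1}\otimes\dots\check\xi_{f_i}\dots\otimes\xi_{f_n}).$$ For a subdivision $\mathcal I=\{I_i\}$ of an interval $[u,v)$ into finitely many intervals $[t_{i-1},t_i)$, $u=t_0<\dots<t_N=v$, let $\delta(\mathcal I)$ be the largest length of the $I_i$. \textbf{Proposition.} \begin{enumerate} \item For every $U\in\mathcal A$ and all $0\le u\le v$, the limit $$\int_0^\infty dX(t)\,\mathbf 1_{[u,v)}(t)\,U\,dX(t):=\lim_{\delta(\mathcal I)\to0}\sum_iX(I_i)\,U\,X(I_i),$$ over subdivisions $\mathcal I=\{I_i\}$ of $[u,v)$, exists in $L^2(\varphi)$.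 \item This definition extends uniquely to a linear map $U\mapsto\int_0^\infty dX(t)\,U(t)\,dX(t)$ from the space of simple adapted algebraic processes, that is, of finite sums $U(t)=\sum_iU_i\mathbf 1_{[a_i,b_i)}(t)$ with $U_i\in\mathcal A(a_i)$, to $L^2(\varphi)$. \item For every $t\ge 0$ there is a unique $\Delta_2(t)\in\mathcal A$ such that $\sum_iX(I_i)^2\to\Delta_2(t)$ in $L^2(\varphi)$ as $\delta(\mathcal I)\to0$, over subdivisions of $[0,t)$. There is a unique linear map $\Gamma_q(q):\mathcal A\to\mathcal A$ with $\Gamma_q(q)(W(\xi_{f_1}\otimes\dots\otimes\xi_{f_n}))=q^nW(\xi_{f_1}\otimes\dots\otimes\xi_{f_n})$ for all $n\ge 0$ and all $f_1,\dots,f_n$. \item For every simple adapted algebraic process $U(t)=\sum_iU_i\mathbf 1_{[a_i,b_i)}(t)$ with $U_i\in\mathcal A(a_i)$, $$\int_0^\infty dX(t)\,U(t)\,dX(t)=\int_0^\infty d\Delta_2(t)\,\Gamma_q(q)(U(t)):=\sum_i\bigl(\Delta_2(b_i)-\Delta_2(a_i)\bigr)\,\Gamma_q(q)(U_i).$$ \end{enumerate}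 -/

import Mathlib

noncomputable section

open scoped TensorProduct DirectSum
open Filter Topology MeasureTheory

namespace QFock

variable {E : Type*} [NormedAddCommGroup E] [InnerProductSpace ℂ E]

variable (E) in
/-- The algebraic tensor power `E^{⊗ n}`, the `n`-particle space. -/
abbrev TPow (n : ℕ) : Type _ := ⨂[ℂ] _ : Fin n, E

/-- `bra ξ` is the functional `η₁ ⊗ ⋯ ⊗ ηₙ ↦ ∏ ⟨ξ_i, η_i⟩`. -/
def bra {n : ℕ} (ξ : Fin n → E) : TPow E n →ₗ[ℂ] ℂ :=
  PiTensorProduct.dualDistrib (PiTensorProduct.tprod ℂ fun i => (innerₛₗ ℂ (ξ i) : Module.Dual ℂ E))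

theorem bra_tprod {n : ℕ} (ξ η : Fin n → E) :
    bra ξ (PiTensorProduct.tprod ℂ η) = ∏ i, inner ℂ (ξ i) (η i) := by
  simp [bra]

theorem innerₛₗ_update {n : ℕ} (ξ : Fin n → E) (i : Fin n) (z : E) :
    (fun j => (innerₛₗ ℂ (Function.update ξ i z j) : Module.Dual ℂ E))
      = Function.update (fun j => (innerₛₗ ℂ (ξ j) : Module.Dual ℂ E)) i (innerₛₗ ℂ z) := by
  funext j
  by_cases h : j = i
  · subst h; simp
  · simp [h]

/-- The multilinear map `ξ ↦ conj (bra ξ w)`. -/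
def braStar {n : ℕ} (w : TPow E n) : MultilinearMap ℂ (fun _ : Fin n => E) ℂ :=
  .mk' (fun ξ => star (bra ξ w))
    (fun ξ i x y => by
      simp only [bra, innerₛₗ_update, map_add, MultilinearMap.map_update_add,
        LinearMap.add_apply, star_add])
    (fun ξ i c x => by
      simp only [bra, innerₛₗ_update, LinearMap.map_smulₛₗ, MultilinearMap.map_update_smul,
        LinearMap.smul_apply, smul_eq_mul]
      simp)

/-- The inner product `⟨ξ₁ ⊗ ⋯ ⊗ ξₙ, η₁ ⊗ ⋯ ⊗ ηₙ⟩₀ = ∏ ⟨ξ_i, η_i⟩`, conjugate-linear on the left. -/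
def inner₀ {n : ℕ} (v w : TPow E n) : ℂ := star (PiTensorProduct.lift (braStar w) v)

theorem inner₀_tprod_left {n : ℕ} (ξ : Fin n → E) (w : TPow E n) :
    inner₀ (PiTensorProduct.tprod ℂ ξ) w = bra ξ w := by
  simp [inner₀, braStar]

theorem inner₀_tprod {n : ℕ} (ξ η : Fin n → E) :
    inner₀ (PiTensorProduct.tprod ℂ ξ) (PiTensorProduct.tprod ℂ η) = ∏ i, inner ℂ (ξ i) (η i) := by
  rw [inner₀_tprod_left, bra_tprod]

theorem inner₀_add_left {n : ℕ} (v v' w : TPow E n) :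
    inner₀ (v + v') w = inner₀ v w + inner₀ v' w := by
  simp [inner₀]

theorem inner₀_smul_left {n : ℕ} (c : ℂ) (v w : TPow E n) :
    inner₀ (c • v) w = star c * inner₀ v w := by
  simp [inner₀]

theorem inner₀_add_right {n : ℕ} (v w w' : TPow E n) :
    inner₀ v (w + w') = inner₀ v w + inner₀ v w' := by
  induction v using PiTensorProduct.induction_on with
  | smul_tprod r f => simp only [inner₀_smul_left, inner₀_tprod_left, map_add, mul_add]
  | add x y hx hy => simp only [inner₀_add_left, hx, hy]; ring

theorem inner₀_smul_right {n : ℕ} (c : ℂ) (v w : TPow E n) :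
    inner₀ v (c • w) = c * inner₀ v w := by
  induction v using PiTensorProduct.induction_on with
  | smul_tprod r f =>
      simp only [inner₀_smul_left, inner₀_tprod_left, map_smul, smul_eq_mul]; ring
  | add x y hx hy => simp only [inner₀_add_left, hx, hy]; ring

theorem inner₀_symm {n : ℕ} (v w : TPow E n) : star (inner₀ w v) = inner₀ v w := by
  induction v using PiTensorProduct.induction_on with
  | smul_tprod r f =>
    induction w using PiTensorProduct.induction_on with
    | smul_tprod s g =>
      simp only [inner₀_smul_left, inner₀_smul_right, inner₀_tprod]
      simp [mul_left_comm]
    | add x y hx hy => simp only [inner₀_add_left, inner₀_add_right, star_add, hx, hy]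
  | add x y hx hy => simp only [inner₀_add_left, inner₀_add_right, star_add, hx, hy]

/-- `inner₀` as a sesquilinear map. -/
def innerₗ {n : ℕ} : TPow E n →ₗ⋆[ℂ] TPow E n →ₗ[ℂ] ℂ :=
  LinearMap.mk₂'ₛₗ (starRingEnd ℂ) (RingHom.id ℂ) inner₀ inner₀_add_left inner₀_smul_left
    inner₀_add_right inner₀_smul_right

theorem innerₗ_apply {n : ℕ} (v w : TPow E n) : innerₗ v w = inner₀ v w := rfl

theorem inner₀_sum_sum {n : ℕ} {ι κ : Type*} (s : Finset ι) (t : Finset κ) (v : ι → TPow E n)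
    (w : κ → TPow E n) :
    inner₀ (∑ i ∈ s, v i) (∑ j ∈ t, w j) = ∑ i ∈ s, ∑ j ∈ t, inner₀ (v i) (w j) := by
  simp only [← innerₗ_apply, map_sum, LinearMap.sum_apply]
  rw [Finset.sum_comm]

/-- Every tensor is an expansion along an orthonormal family. -/
theorem exists_orthonormal_expansion {n : ℕ} (w : TPow E n) :
    ∃ (m : ℕ) (b : Fin m → E) (d : (Fin n → Fin m) → ℂ), Orthonormal ℂ b ∧
      w = ∑ κ, d κ • PiTensorProduct.tprod ℂ fun i => b (κ i) := by
  have h1 : ∃ F : Submodule ℂ E, FiniteDimensional ℂ F ∧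
      w ∈ LinearMap.range (PiTensorProduct.mapIncl fun _ : Fin n => F) := by
    induction w using PiTensorProduct.induction_on with
    | smul_tprod r f =>
      refine ⟨Submodule.span ℂ (Set.range f), FiniteDimensional.span_of_finite ℂ (Set.finite_range f), Submodule.smul_mem _ _ ?_⟩
      exact ⟨PiTensorProduct.tprod ℂ fun i => ⟨f i, Submodule.subset_span ⟨i, rfl⟩⟩, by
        simp [PiTensorProduct.mapIncl]⟩
    | add x y hx hy =>
      obtain ⟨F, hF, x', rfl⟩ := hx
      obtain ⟨G, hG, y', rfl⟩ := hy
      have mono : ∀ (A B : Submodule ℂ E) (hAB : A ≤ B) (z : ⨂[ℂ] _ : Fin n, A),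
          PiTensorProduct.mapIncl (fun _ : Fin n => A) z
            ∈ LinearMap.range (PiTensorProduct.mapIncl fun _ : Fin n => B) := by
        intro A B hAB z
        refine ⟨PiTensorProduct.map (fun _ => Submodule.inclusion hAB) z, ?_⟩
        rw [PiTensorProduct.mapIncl, PiTensorProduct.mapIncl, ← LinearMap.comp_apply,
          ← PiTensorProduct.map_comp]
        rfl
      exact ⟨F ⊔ G, inferInstance,
        Submodule.add_mem _ (mono _ _ le_sup_left _) (mono _ _ le_sup_right _)⟩
  obtain ⟨F, hF, y, rfl⟩ := h1
  let b := stdOrthonormalBasis ℂ F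
  let B := Basis.piTensorProduct (fun _ : Fin n => b.toBasis)
  refine ⟨_, fun i => (b i : E), fun κ => B.repr y κ, ?_, ?_⟩
  · exact b.orthonormal.comp_linearIsometry F.subtypeₗᵢ
  · conv_lhs => rw [← B.sum_repr y]
    simp [B, PiTensorProduct.mapIncl]

theorem inner₀_self_expansion {n m : ℕ} {b : Fin m → E} (hb : Orthonormal ℂ b)
    (d : (Fin n → Fin m) → ℂ) :
    inner₀ (∑ κ, d κ • PiTensorProduct.tprod ℂ fun i => b (κ i))
      (∑ κ, d κ • PiTensorProduct.tprod ℂ fun i => b (κ i)) = ((∑ κ, ‖d κ‖ ^ 2 : ℝ) : ℂ) := by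
  classical
  rw [inner₀_sum_sum]
  simp only [inner₀_smul_left, inner₀_smul_right, inner₀_tprod, orthonormal_iff_ite.mp hb,
    Fintype.prod_ite_zero, ← funext_iff]
  push_cast
  refine Finset.sum_congr rfl fun κ _ => ?_
  rw [Finset.sum_eq_single κ]
  · simpa [mul_comm] using RCLike.conj_mul (d κ)
  · intro κ' _ h; simp [h.symm]
  · simp

theorem inner₀_self_nonneg {n : ℕ} (w : TPow E n) : 0 ≤ (inner₀ w w).re := by
  obtain ⟨m, b, d, hb, rfl⟩ := exists_orthonormal_expansion w
  rw [inner₀_self_expansion hb, Complex.ofReal_re]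
  positivity

theorem inner₀_definite {n : ℕ} (w : TPow E n) (h : (inner₀ w w).re = 0) : w = 0 := by
  obtain ⟨m, b, d, hb, rfl⟩ := exists_orthonormal_expansion w
  rw [inner₀_self_expansion hb, Complex.ofReal_re,
    Finset.sum_eq_zero_iff_of_nonneg fun _ _ => sq_nonneg _] at h
  refine Finset.sum_eq_zero fun κ hκ => ?_
  have := h κ hκ
  simp at this
  simp [this]

/-- The number of inversions of a permutation. -/
def inversions {n : ℕ} (σ : Equiv.Perm (Fin n)) : ℕ :=
  (Finset.univ.filter fun p : Fin n × Fin n => p.1 < p.2 ∧ σ p.2 < σ p.1).card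

/-- `ξ₁ ⊗ ⋯ ⊗ ξₙ ↦ ξ_{σ(1)} ⊗ ⋯ ⊗ ξ_{σ(n)}`. -/
def permute {n : ℕ} (σ : Equiv.Perm (Fin n)) : TPow E n →ₗ[ℂ] TPow E n :=
  (PiTensorProduct.reindex ℂ (fun _ : Fin n => E) σ.symm).toLinearMap

theorem permute_tprod {n : ℕ} (σ : Equiv.Perm (Fin n)) (ξ : Fin n → E) :
    permute σ (PiTensorProduct.tprod ℂ ξ) = PiTensorProduct.tprod ℂ fun i => ξ (σ i) := by
  simp [permute]

/-- `P_n = ∑ σ, q ^ inversions σ • permute σ`. -/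
def symmetrizer (q : ℝ) (n : ℕ) : TPow E n →ₗ[ℂ] TPow E n :=
  ∑ σ : Equiv.Perm (Fin n), ((q : ℂ) ^ inversions σ) • permute σ

/-- `⟨v, w⟩_q = ⟨v, P_n w⟩₀` on the `n`-particle space. -/
def innerq (q : ℝ) {n : ℕ} (v w : TPow E n) : ℂ := inner₀ v (symmetrizer q n w)

theorem permute_mul {n : ℕ} (σ τ : Equiv.Perm (Fin n)) (w : TPow E n) :
    permute σ (permute τ w) = permute (τ * σ) w := by
  induction w using PiTensorProduct.induction_on with
  | smul_tprod r f => simp [permute_tprod]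
  | add x y hx hy => simp only [map_add, hx, hy]

theorem inner₀_permute {n : ℕ} (σ : Equiv.Perm (Fin n)) (v w : TPow E n) :
    inner₀ (permute σ v) (permute σ w) = inner₀ v w := by
  induction v using PiTensorProduct.induction_on with
  | smul_tprod r f =>
    induction w using PiTensorProduct.induction_on with
    | smul_tprod s g =>
      simp only [map_smul, inner₀_smul_left, inner₀_smul_right, permute_tprod, inner₀_tprod]
      rw [Equiv.prod_comp σ fun i => (inner ℂ (f i) (g i) : ℂ)]
    | add x y hx hy => simp only [map_add, inner₀_add_right, hx, hy]
  | add x y hx hy => simp only [map_add, inner₀_add_left, hx, hy]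

/-- The pairs of positions. -/
def pairs (n : ℕ) : Finset (Fin n × Fin n) := Finset.univ.filter fun p => p.1 < p.2

/-- The sign telling whether a permutation preserves the order of a pair of positions. -/
def orderSign {n : ℕ} (σ : Equiv.Perm (Fin n)) (p : Fin n × Fin n) : ℝ :=
  if σ p.1 < σ p.2 then 1 else -1

theorem inversions_mul_inv {n : ℕ} (σ τ : Equiv.Perm (Fin n)) :
    inversions (τ * σ⁻¹)
      = ((pairs n).filter fun p => orderSign σ p ≠ orderSign τ p).card := by
  have h1 : inversions (τ * σ⁻¹) = (Finset.univ.filter fun p : Fin n × Fin n =>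
      σ p.1 < σ p.2 ∧ τ p.2 < τ p.1).card := by
    rw [inversions]
    refine (Finset.card_equiv (Equiv.prodCongr σ σ) fun p => ?_).symm
    simp only [Finset.mem_filter, Finset.mem_univ, true_and]
    simp
  have h2 : (Finset.univ.filter fun p : Fin n × Fin n => σ p.1 < σ p.2 ∧ τ p.2 < τ p.1)
      = ((pairs n).filter fun p => σ p.1 < σ p.2 ∧ τ p.2 < τ p.1) ∪
        ((pairs n).filter fun p => σ p.2 < σ p.1 ∧ τ p.1 < τ p.2).map
          (Equiv.prodComm (Fin n) (Fin n)).toEmbedding := by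
    ext ⟨a, b⟩
    simp only [pairs, Finset.mem_filter, Finset.mem_univ, true_and, Finset.mem_union,
      Finset.mem_map_equiv, Equiv.prodComm_symm, Equiv.prodComm_apply, Prod.swap]
    rcases lt_trichotomy a b with h | h | h
    · simp [h, not_lt.mpr h.le]
    · subst h; simp
    · simp [h, not_lt.mpr h.le]
  have h3 : ((pairs n).filter fun p => orderSign σ p ≠ orderSign τ p)
      = ((pairs n).filter fun p => σ p.1 < σ p.2 ∧ τ p.2 < τ p.1) ∪
        ((pairs n).filter fun p => σ p.2 < σ p.1 ∧ τ p.1 < τ p.2) := by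
    ext ⟨a, b⟩
    rw [Finset.mem_filter, Finset.mem_union, Finset.mem_filter, Finset.mem_filter, pairs,
      Finset.mem_filter, orderSign, orderSign]
    simp only [Finset.mem_univ, true_and]
    by_cases h : a < b
    · have hs : σ a ≠ σ b := fun e => h.ne (σ.injective e)
      have ht : τ a ≠ τ b := fun e => h.ne (τ.injective e)
      rcases lt_or_gt_of_ne hs with h4 | h4 <;> rcases lt_or_gt_of_ne ht with h5 | h5 <;>
        simp [h, h4, h5, not_lt.mpr h4.le, not_lt.mpr h5.le] <;> norm_num
    · simp [h]
  rw [h1, h2, h3, Finset.card_union_of_disjoint, Finset.card_union_of_disjoint, Finset.card_map]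
  · rw [Finset.disjoint_left]
    rintro ⟨a, b⟩ h h'
    simp only [Finset.mem_filter] at h h'
    exact lt_asymm h.2.1 h'.2.1
  · rw [Finset.disjoint_left]
    rintro ⟨a, b⟩ h h'
    simp only [pairs, Finset.mem_filter, Finset.mem_univ, true_and,
      Finset.mem_map_equiv, Equiv.prodComm_symm, Equiv.prodComm_apply, Prod.swap] at h h'
    exact lt_asymm h.1 h'.1

theorem orderSign_cases {n : ℕ} (σ : Equiv.Perm (Fin n)) (p : Fin n × Fin n) :
    orderSign σ p = 1 ∨ orderSign σ p = -1 := by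
  unfold orderSign; split_ifs <;> simp

/-- The kernel `q ^ inversions (τ σ⁻¹)` is a combination of rank-one kernels. -/
theorem pow_inversions {n : ℕ} (q : ℝ) (σ τ : Equiv.Perm (Fin n)) :
    q ^ inversions (τ * σ⁻¹) = ∑ A ∈ (pairs n).powerset,
      (((1 - q) / 2) ^ A.card * ((1 + q) / 2) ^ (pairs n \ A).card) *
        ((∏ p ∈ A, orderSign σ p) * ∏ p ∈ A, orderSign τ p) := by
  have h : q ^ inversions (τ * σ⁻¹)
      = ∏ p ∈ pairs n, ((1 - q) / 2 * (orderSign σ p * orderSign τ p) + (1 + q) / 2) := by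
    rw [inversions_mul_inv, ← Finset.prod_const, Finset.prod_filter]
    refine Finset.prod_congr rfl fun p _ => ?_
    rcases orderSign_cases σ p with h1 | h1 <;> rcases orderSign_cases τ p with h2 | h2 <;>
      simp only [h1, h2] <;> norm_num <;> ring
  rw [h, Finset.prod_add]
  refine Finset.sum_congr rfl fun A _ => ?_
  rw [Finset.prod_mul_distrib, Finset.prod_mul_distrib, Finset.prod_const, Finset.prod_const]
  ring

/-- Auxiliary to the positivity of the `q`-inner product. -/
def signSum {n : ℕ} (A : Finset (Fin n × Fin n)) (w : TPow E n) : TPow E n :=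
  ∑ σ : Equiv.Perm (Fin n), ((∏ p ∈ A, orderSign σ p : ℝ) : ℂ) • permute σ w

theorem innerq_eq_sum {n : ℕ} (q : ℝ) (v w : TPow E n) :
    (n.factorial : ℂ) * innerq q v w = ∑ A ∈ (pairs n).powerset,
      ((((1 - q) / 2) ^ A.card * ((1 + q) / 2) ^ (pairs n \ A).card : ℝ) : ℂ) *
        inner₀ (signSum A v) (signSum A w) := by
  have h1 : ∀ σ : Equiv.Perm (Fin n), innerq q v w
      = ∑ τ : Equiv.Perm (Fin n), ((q ^ inversions (τ * σ⁻¹) : ℝ) : ℂ) *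
          inner₀ (permute σ v) (permute τ w) := by
    intro σ
    have h2 : innerq q v w
        = ∑ τ : Equiv.Perm (Fin n), ((q ^ inversions τ : ℝ) : ℂ) * inner₀ v (permute τ w) := by
      simp only [innerq, symmetrizer, ← innerₗ_apply, LinearMap.sum_apply, map_sum,
        LinearMap.smul_apply, map_smul, smul_eq_mul]
      push_cast; rfl
    rw [h2]
    refine Fintype.sum_equiv (Equiv.mulRight σ) _ _ fun τ => ?_
    rw [Equiv.coe_mulRight, mul_inv_cancel_right, ← permute_mul, inner₀_permute]
  have h3 : (n.factorial : ℂ) * innerq q v w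
      = ∑ σ : Equiv.Perm (Fin n), ∑ τ : Equiv.Perm (Fin n),
          ((q ^ inversions (τ * σ⁻¹) : ℝ) : ℂ) * inner₀ (permute σ v) (permute τ w) := by
    rw [Finset.sum_congr rfl fun σ _ => (h1 σ).symm]
    simp [Fintype.card_perm]
  rw [h3]
  have h4 : ∀ σ τ : Equiv.Perm (Fin n),
      ((q ^ inversions (τ * σ⁻¹) : ℝ) : ℂ) * inner₀ (permute σ v) (permute τ w)
        = ∑ A ∈ (pairs n).powerset,
          ((((1 - q) / 2) ^ A.card * ((1 + q) / 2) ^ (pairs n \ A).card : ℝ) : ℂ) *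
            (((∏ p ∈ A, orderSign σ p : ℝ) : ℂ) * (((∏ p ∈ A, orderSign τ p : ℝ) : ℂ) *
              inner₀ (permute σ v) (permute τ w))) := by
    intro σ τ
    rw [pow_inversions, Complex.ofReal_sum, Finset.sum_mul]
    refine Finset.sum_congr rfl fun A _ => ?_
    push_cast
    ring
  rw [Finset.sum_congr rfl fun σ _ => Finset.sum_congr rfl fun τ _ => h4 σ τ,
    Finset.sum_congr rfl fun σ _ => Finset.sum_comm, Finset.sum_comm]
  refine Finset.sum_congr rfl fun A _ => ?_
  simp only [signSum, inner₀_sum_sum, inner₀_smul_left, inner₀_smul_right, Finset.mul_sum]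
  refine Finset.sum_congr rfl fun σ _ => Finset.sum_congr rfl fun τ _ => ?_
  rw [Complex.star_def, Complex.conj_ofReal]
  ring

theorem sum_signSum {n : ℕ} (w : TPow E n) :
    ∑ A ∈ (pairs n).powerset, signSum A w = ((2 : ℂ) ^ (pairs n).card) • w := by
  have h1 : ∀ σ : Equiv.Perm (Fin n), ∑ A ∈ (pairs n).powerset, ∏ p ∈ A, orderSign σ p
      = if σ = 1 then (2 : ℝ) ^ (pairs n).card else 0 := by
    intro σ
    have h2 : ∑ A ∈ (pairs n).powerset, ∏ p ∈ A, orderSign σ p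
        = ∏ p ∈ pairs n, (orderSign σ p + 1) := by
      rw [Finset.prod_add]; simp
    rw [h2]
    split_ifs with hσ
    · subst hσ
      rw [← Finset.prod_const]
      refine Finset.prod_congr rfl fun p hp => ?_
      have : p.1 < p.2 := by simpa [pairs] using hp
      simp [orderSign, this]; norm_num
    · by_contra hne
      apply hσ
      have hmono : StrictMono σ := by
        intro a b hab
        by_contra hlt
        refine hne (Finset.prod_eq_zero (i := (a, b)) (by simp [pairs, hab]) ?_)
        simp [orderSign, hlt]
      ext i
      have := Subsingleton.elim (hmono.orderIsoOfSurjective σ σ.surjective) (OrderIso.refl _)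
      exact congrArg (fun e : Fin n ≃o Fin n => ((e i : Fin n) : ℕ)) this
  simp only [signSum]
  rw [Finset.sum_comm]
  simp only [← Finset.sum_smul, ← Complex.ofReal_sum, h1]
  rw [Finset.sum_eq_single 1]
  · induction w using PiTensorProduct.induction_on with
    | smul_tprod r f => simp [permute_tprod]
    | add x y hx hy => rw [map_add, smul_add, hx, hy, smul_add]
  · intro σ _ hσ; simp [hσ]
  · simp

theorem innerq_symm {n : ℕ} (q : ℝ) (v w : TPow E n) : star (innerq q w v) = innerq q v w := by
  have h0 : (n.factorial : ℂ) ≠ 0 := by exact_mod_cast n.factorial_ne_zero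
  apply mul_left_cancel₀ h0
  have h1 := congrArg star (innerq_eq_sum q w v)
  rw [innerq_eq_sum q v w]
  rw [star_mul', star_natCast] at h1
  rw [h1, star_sum]
  refine Finset.sum_congr rfl fun A _ => ?_
  rw [star_mul', inner₀_symm, Complex.star_def, Complex.conj_ofReal]

theorem factorial_mul_innerq_re {n : ℕ} (q : ℝ) (w : TPow E n) :
    (n.factorial : ℝ) * (innerq q w w).re = ∑ A ∈ (pairs n).powerset,
      (((1 - q) / 2) ^ A.card * ((1 + q) / 2) ^ (pairs n \ A).card) *
        (inner₀ (signSum A w) (signSum A w)).re := by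
  have h := congrArg Complex.re (innerq_eq_sum q w w)
  rw [Complex.re_sum] at h
  simp only [Complex.re_ofReal_mul] at h
  rw [← h, ← Complex.ofReal_natCast, Complex.re_ofReal_mul]

theorem innerq_self_nonneg {n : ℕ} {q : ℝ} (hq : q ∈ Set.Ioo (-1 : ℝ) 1) (w : TPow E n) :
    0 ≤ (innerq q w w).re := by
  have h0 : (0 : ℝ) < n.factorial := by exact_mod_cast n.factorial_pos
  have h1 : 0 ≤ (n.factorial : ℝ) * (innerq q w w).re := by
    rw [factorial_mul_innerq_re]
    refine Finset.sum_nonneg fun A _ => mul_nonneg ?_ (inner₀_self_nonneg _)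
    exact mul_nonneg (pow_nonneg (by linarith [hq.2]) _) (pow_nonneg (by linarith [hq.1]) _)
  exact nonneg_of_mul_nonneg_right h1 h0

theorem innerq_definite {n : ℕ} {q : ℝ} (hq : q ∈ Set.Ioo (-1 : ℝ) 1) (w : TPow E n)
    (h : (innerq q w w).re = 0) : w = 0 := by
  have h1 := factorial_mul_innerq_re q w
  have hpos : ∀ A : Finset (Fin n × Fin n),
      0 < ((1 - q) / 2) ^ A.card * ((1 + q) / 2) ^ (pairs n \ A).card := fun A =>
    mul_pos (pow_pos (by linarith [hq.2]) _) (pow_pos (by linarith [hq.1]) _)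
  rw [h, mul_zero, eq_comm, Finset.sum_eq_zero_iff_of_nonneg fun A _ =>
    mul_nonneg (hpos A).le (inner₀_self_nonneg _)] at h1
  have h2 : ∀ A ∈ (pairs n).powerset, signSum A w = 0 := fun A hA =>
    inner₀_definite _ ((mul_eq_zero.mp (h1 A hA)).resolve_left (hpos A).ne')
  have h3 := sum_signSum w
  rw [Finset.sum_eq_zero h2, eq_comm, smul_eq_zero] at h3
  exact h3.resolve_left (pow_ne_zero _ two_ne_zero)

/-! ### The algebraic `q`-Fock space -/

variable (E) in
/-- The algebraic Fock space, the direct sum of the `E^{⊗ n}`; the parameter `q` selects the inner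
product. -/
def Fock (_q : Set.Ioo (-1 : ℝ) 1) : Type _ := ⨁ n, TPow E n

variable {q : Set.Ioo (-1 : ℝ) 1}

instance : AddCommGroup (Fock E q) := inferInstanceAs (AddCommGroup (⨁ n, TPow E n))

instance : Module ℂ (Fock E q) := inferInstanceAs (Module ℂ (⨁ n, TPow E n))

variable (q) in
/-- The inclusion of the `n`-particle space. -/
def particles (n : ℕ) : TPow E n →ₗ[ℂ] Fock E q := DirectSum.lof ℂ ℕ (TPow E) n

/-- The `n`-particle component. -/
def component (n : ℕ) : Fock E q →ₗ[ℂ] TPow E n := DirectSum.component ℂ ℕ (TPow E) n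

theorem component_particles (n : ℕ) (w : TPow E n) : component n (particles q n w) = w :=
  DirectSum.component.lof_self ℂ _ _

theorem component_particles_of_ne {n m : ℕ} (h : n ≠ m) (w : TPow E n) :
    component m (particles q n w) = 0 :=
  DirectSum.of_eq_of_ne n m w h.symm

/-- A linear map out of the Fock space is given by its restrictions to the particle spaces. -/
def fromParticles {F : Type*} [AddCommGroup F] [Module ℂ F] (f : ∀ n, TPow E n →ₗ[ℂ] F) :
    Fock E q →ₗ[ℂ] F := DirectSum.toModule ℂ ℕ F f

theorem fromParticles_particles {F : Type*} [AddCommGroup F] [Module ℂ F]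
    (f : ∀ n, TPow E n →ₗ[ℂ] F) (n : ℕ) (w : TPow E n) :
    fromParticles f (particles q n w) = f n w := DirectSum.toModule_lof ℂ n w

variable (q) in
/-- The elementary tensor `ξ₁ ⊗ ⋯ ⊗ ξₙ` as an element of the Fock space. -/
def tensor {n : ℕ} (ξ : Fin n → E) : Fock E q := particles q n (PiTensorProduct.tprod ℂ ξ)

variable (E q) in
/-- The vacuum vector `Ω`. -/
def vacuum : Fock E q := tensor q (Fin.elim0 : Fin 0 → E)

/-- The `q`-inner product: different particle spaces are orthogonal, and on the `n`-particle space
it is `⟨v, P_n w⟩₀`. -/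
def fockInner (v w : Fock E q) : ℂ :=
  fromParticles (fun n => innerₗ (component n v) ∘ₗ symmetrizer (q : ℝ) n) w

theorem fockInner_eq_sum (v w : Fock E q) :
    ∃ s : Finset ℕ, (∀ n ∉ s, component n w = 0) ∧
      fockInner v w = ∑ n ∈ s, innerq (q : ℝ) (component n v) (component n w) := by
  classical
  let w' : Π₀ n, TPow E n := w
  refine ⟨w'.support, fun n hn => by
    have h : w' n = 0 := by simpa using hn
    exact h, ?_⟩
  have : fockInner v w = DFinsupp.sumAddHom
      (fun n => (innerₗ (component n v) ∘ₗ symmetrizer (q : ℝ) n).toAddMonoidHom) w' := rfl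
  rw [this, DFinsupp.sumAddHom_apply]
  rfl

theorem fockInner_eq_sum_of_subset {v w : Fock E q} {s : Finset ℕ}
    (hs : ∀ n ∉ s, component n w = 0) :
    fockInner v w = ∑ n ∈ s, innerq (q : ℝ) (component n v) (component n w) := by
  classical
  obtain ⟨t, ht, h⟩ := fockInner_eq_sum v w
  have h0 : ∀ n, component n w = 0 → innerq (q : ℝ) (component n v) (component n w) = 0 := by
    intro n hn
    rw [hn, innerq, map_zero, ← innerₗ_apply, map_zero]
  rw [h, Finset.sum_subset (Finset.subset_union_left : t ⊆ t ∪ s) fun n _ hn => h0 n (ht n hn),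
    Finset.sum_subset (Finset.subset_union_right : s ⊆ t ∪ s) fun n _ hn => h0 n (hs n hn)]

/-- The algebraic Fock space with its (positive definite) `q`-inner product. -/
instance : InnerProductSpace.Core ℂ (Fock E q) where
  inner := fockInner
  conj_inner_symm v w := by
    classical
    obtain ⟨s, hs, -⟩ := fockInner_eq_sum w v
    obtain ⟨t, ht, -⟩ := fockInner_eq_sum v w
    rw [fockInner_eq_sum_of_subset (s := s ∪ t) fun n hn => hs n (by simp at hn; tauto),
      fockInner_eq_sum_of_subset (s := s ∪ t) fun n hn => ht n (by simp at hn; tauto), map_sum]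
    exact Finset.sum_congr rfl fun n _ => innerq_symm _ _ _
  re_inner_nonneg v := by
    obtain ⟨s, -, h⟩ := fockInner_eq_sum v v
    change 0 ≤ (fockInner v v).re
    rw [h, Complex.re_sum]
    exact Finset.sum_nonneg fun n _ => innerq_self_nonneg q.2 _
  add_left v v' w := by
    obtain ⟨s, hs, h⟩ := fockInner_eq_sum w w
    rw [fockInner_eq_sum_of_subset hs, fockInner_eq_sum_of_subset hs,
      fockInner_eq_sum_of_subset hs, ← Finset.sum_add_distrib]
    refine Finset.sum_congr rfl fun n _ => ?_
    rw [map_add]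
    exact inner₀_add_left _ _ _
  smul_left v w c := by
    obtain ⟨s, hs, h⟩ := fockInner_eq_sum w w
    rw [fockInner_eq_sum_of_subset hs, fockInner_eq_sum_of_subset hs, Finset.mul_sum]
    refine Finset.sum_congr rfl fun n _ => ?_
    rw [map_smul]
    exact inner₀_smul_left _ _ _
  definite v hv := by
    obtain ⟨s, hs, h⟩ := fockInner_eq_sum v v
    have h1 : (fockInner v v).re = 0 := by
      have := congrArg Complex.re hv
      simpa using this
    rw [h, Complex.re_sum,
      Finset.sum_eq_zero_iff_of_nonneg fun n _ => innerq_self_nonneg q.2 _] at h1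
    refine DFinsupp.ext fun n => ?_
    by_cases hn : n ∈ s
    · exact innerq_definite q.2 _ (h1 n hn)
    · exact hs n hn

instance : NormedAddCommGroup (Fock E q) :=
  InnerProductSpace.Core.toNormedAddCommGroup (𝕜 := ℂ)

instance : InnerProductSpace ℂ (Fock E q) := InnerProductSpace.ofCore _

theorem inner_tensor_tensor {n : ℕ} (ξ η : Fin n → E) :
    inner ℂ (tensor q ξ) (tensor q η)
      = ∑ σ : Equiv.Perm (Fin n), ((q : ℝ) : ℂ) ^ inversions σ * ∏ i, inner ℂ (ξ i) (η (σ i)) := by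
  have h : component n (tensor q ξ) = PiTensorProduct.tprod ℂ ξ :=
    component_particles _ _
  change fockInner _ _ = _
  rw [fockInner, tensor, tensor, fromParticles_particles, LinearMap.comp_apply]
  rw [tensor] at h
  rw [h, innerₗ_apply, inner₀_tprod_left]
  simp [symmetrizer, permute_tprod, bra_tprod]

theorem inner_tensor_tensor_of_ne {n m : ℕ} (h : n ≠ m) (ξ : Fin n → E) (η : Fin m → E) :
    inner ℂ (tensor q ξ) (tensor q η) = 0 := by
  have h : component m (tensor q ξ) = 0 := component_particles_of_ne h _
  change fockInner _ _ = _
  rw [fockInner, tensor, tensor, fromParticles_particles, LinearMap.comp_apply]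
  rw [tensor] at h
  rw [h, map_zero, LinearMap.zero_apply]

/-- `a*(ζ) (η₁ ⊗ ⋯ ⊗ ηₙ) = ζ ⊗ η₁ ⊗ ⋯ ⊗ ηₙ`. -/
def creation (ζ : E) : Fock E q →ₗ[ℂ] Fock E q :=
  fromParticles fun n => particles q (n + 1) ∘ₗ PiTensorProduct.lift
    ((PiTensorProduct.tprod ℂ (s := fun _ : Fin (n + 1) => E)).curryLeft ζ)

/-- `a(ζ) (η₁ ⊗ ⋯ ⊗ ηₙ) = ∑ k, q ^ (k - 1) ⟨ζ, η_k⟩ η₁ ⊗ ⋯ (without η_k) ⋯ ⊗ ηₙ`. -/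
def annihilation (ζ : E) : Fock E q →ₗ[ℂ] Fock E q :=
  fromParticles fun
    | 0 => 0
    | n + 1 => particles q n ∘ₗ ∑ k : Fin (n + 1), (((q : ℝ) : ℂ) ^ (k : ℕ)) • PiTensorProduct.lift
        (LinearMap.uncurryMid k
          ((innerₛₗ ℂ ζ).smulRight (PiTensorProduct.tprod ℂ (s := fun _ : Fin n => E))))

/-- `p(T) (η₁ ⊗ ⋯ ⊗ ηₙ) = ∑ k, q ^ (k - 1) (T η_k) ⊗ η₁ ⊗ ⋯ (without η_k) ⋯ ⊗ ηₙ`. -/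
def gauge (T : E →ₗ[ℂ] E) : Fock E q →ₗ[ℂ] Fock E q :=
  fromParticles fun
    | 0 => 0
    | n + 1 => particles q (n + 1) ∘ₗ ∑ k : Fin (n + 1), (((q : ℝ) : ℂ) ^ (k : ℕ)) •
        PiTensorProduct.lift (LinearMap.uncurryMid k
          ((PiTensorProduct.tprod ℂ (s := fun _ : Fin (n + 1) => E)).curryLeft ∘ₗ T))

theorem creation_tensor (ζ : E) {n : ℕ} (η : Fin n → E) :
    creation ζ (tensor q η) = tensor q (Fin.cons ζ η : Fin (n + 1) → E) := by
  rw [creation, tensor, fromParticles_particles, LinearMap.comp_apply, PiTensorProduct.lift.tprod]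
  rfl

theorem annihilation_vacuum (ζ : E) : annihilation ζ (vacuum E q) = 0 := by
  rw [annihilation, vacuum, tensor, fromParticles_particles, LinearMap.zero_apply]

theorem annihilation_tensor (ζ : E) {n : ℕ} (η : Fin (n + 1) → E) :
    annihilation ζ (tensor q η) = ∑ k : Fin (n + 1),
      (((q : ℝ) : ℂ) ^ (k : ℕ) * inner ℂ ζ (η k)) • tensor q (k.removeNth η) := by
  rw [annihilation, tensor, fromParticles_particles]
  simp [tensor, mul_smul]

theorem gauge_vacuum (T : E →ₗ[ℂ] E) : gauge T (vacuum E q) = 0 := by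
  rw [gauge, vacuum, tensor, fromParticles_particles, LinearMap.zero_apply]

theorem gauge_tensor (T : E →ₗ[ℂ] E) {n : ℕ} (η : Fin (n + 1) → E) :
    gauge T (tensor q η) = ∑ k : Fin (n + 1),
      (((q : ℝ) : ℂ) ^ (k : ℕ)) • tensor q (Fin.cons (T (η k)) (k.removeNth η) : Fin (n + 1) → E) := by
  rw [gauge, tensor, fromParticles_particles]
  simp [tensor]

/-- `p(ζ, T) = a(ζ) + a*(ζ) + p(T)`. -/
def field (ζ : E) (T : E →ₗ[ℂ] E) : Module.End ℂ (Fock E q) :=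
  annihilation ζ + creation ζ + gauge T

end QFock

namespace QLevy

open QFock
open scoped ENNReal NNReal

/-! ### The generator of the process -/

/-- The half-open intervals `[lo, hi) ⊂ ℝ₊`. -/
structure Interval where
  lo : ℝ≥0
  hi : ℝ≥0
  le : lo ≤ hi

namespace Interval

/-- The interval as a subset of `ℝ`. -/
def toSet (I : Interval) : Set ℝ := Set.Ico (I.lo : ℝ) (I.hi : ℝ)

/-- The length of the interval. -/
def length (I : Interval) : ℝ := I.hi - I.lo

/-- `[0, t)`. -/
def upTo (t : ℝ≥0) : Interval := ⟨0, t, zero_le⟩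

end Interval

/-- The measure has compact support. -/
class CompactlySupported (ν : Measure ℝ) : Prop where
  exists_compact : ∃ K : Set ℝ, IsCompact K ∧ ν Kᶜ = 0

/-- Words in the noncommuting indeterminates `x_I`; they are nonempty. -/
abbrev Word : Type := FreeSemigroup Interval

/-- Real noncommutative polynomials without constant term in the indeterminates `x_I`. -/
abbrev Poly₀ : Type := MonoidAlgebra ℝ Word

/-- The word `x_I ^ k`, for `k ≥ 1`. -/
def powWord (I : Interval) (k : ℕ) : Word := ⟨I, List.replicate (k - 1) I⟩

/-- The intersection of the intervals of a word. -/
def support (w : Word) : Set ℝ := w.head.toSet ∩ {t | ∀ J ∈ w.tail, t ∈ J.toSet}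

theorem support_subset (w : Word) : support w ⊆ w.head.toSet := Set.inter_subset_left

theorem measurableSet_support (w : Word) : MeasurableSet (support w) := by
  refine measurableSet_Ico.inter ?_
  have : {t : ℝ | ∀ J ∈ w.tail, t ∈ J.toSet} = ⋂ J ∈ {J | J ∈ w.tail}, J.toSet := by
    ext; simp
  rw [this]
  exact MeasurableSet.biInter (List.finite_toSet w.tail).countable fun J _ => measurableSet_Ico

/-- The measure `dt ⊗ ν` on `ℝ₊ × ℝ`. -/
def timeJump (ν : Measure ℝ) : Measure (ℝ × ℝ) := (volume.restrict (Set.Ici 0)).prod ν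

/-- The one-particle Hilbert space `L²(ℝ₊, dt) ⊗ L²(ℝ, ν) ≅ L²(ℝ₊ × ℝ, dt ⊗ ν)`. -/
abbrev H (ν : Measure ℝ) : Type := Lp ℂ 2 (timeJump ν)

/-- The function `χ_A(t) x ^ k`. -/
def monomialFun (A : Set ℝ) (k : ℕ) : ℝ × ℝ → ℂ := fun p => A.indicator (fun _ => (p.2 : ℂ) ^ k) p.1

theorem exists_ae_bound (ν : Measure ℝ) [CompactlySupported ν] :
    ∃ R : ℝ, 0 ≤ R ∧ ∀ᵐ p ∂timeJump ν, |p.2| ≤ R := by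
  obtain ⟨K, hK, hν⟩ := CompactlySupported.exists_compact (ν := ν)
  obtain ⟨R, hR⟩ := hK.isBounded.exists_norm_le
  refine ⟨max R 0, le_max_right _ _, ?_⟩
  have h : ∀ᵐ x ∂ν, |x| ≤ max R 0 := by
    rw [ae_iff]
    refine measure_mono_null (t := Kᶜ) (fun x hx hxK => hx ?_) hν
    exact (hR x hxK).trans (le_max_left _ _)
  exact Measure.quasiMeasurePreserving_snd.ae h

theorem measurable_monomialFun {A : Set ℝ} (hA : MeasurableSet A) (k : ℕ) :
    Measurable (monomialFun A k) := by
  have : monomialFun A k = (A ×ˢ Set.univ).indicator fun p : ℝ × ℝ => (p.2 : ℂ) ^ k := by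
    funext p
    by_cases h : p.1 ∈ A <;> simp [monomialFun, h]
  rw [this]
  exact Measurable.indicator (by fun_prop) (hA.prod MeasurableSet.univ)

theorem memLp_top_monomialFun (ν : Measure ℝ) [CompactlySupported ν] {A : Set ℝ}
    (hA : MeasurableSet A) (k : ℕ) : MemLp (monomialFun A k) ∞ (timeJump ν) := by
  obtain ⟨R, hR, h⟩ := exists_ae_bound ν
  refine memLp_top_of_bound (measurable_monomialFun hA k).aestronglyMeasurable (R ^ k) ?_
  filter_upwards [h] with p hp
  by_cases h1 : p.1 ∈ A
  · simpa [monomialFun, h1] using pow_le_pow_left₀ (abs_nonneg _) hp k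
  · simpa [monomialFun, h1] using pow_nonneg hR k

theorem memLp_two_monomialFun (ν : Measure ℝ) [IsProbabilityMeasure ν] [CompactlySupported ν]
    {A : Set ℝ} (hA : MeasurableSet A) (I : Interval) (hAI : A ⊆ I.toSet) (k : ℕ) :
    MemLp (monomialFun A k) 2 (timeJump ν) := by
  have h1 : MemLp ((I.toSet ×ˢ Set.univ).indicator fun _ : ℝ × ℝ => (1 : ℂ)) 2 (timeJump ν) := by
    refine memLp_indicator_const 2 (measurableSet_Ico.prod MeasurableSet.univ) 1 (Or.inr ?_)
    rw [timeJump, Measure.prod_prod, measure_univ, mul_one]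
    exact ((Measure.restrict_apply_le _ _).trans_lt (by
      change volume (Set.Ico (I.lo : ℝ) I.hi) < ∞; rw [Real.volume_Ico]; exact ENNReal.ofReal_lt_top)).ne
  refine (MemLp.mul (memLp_top_monomialFun ν hA k) h1 (r := 2)).congr_norm
    (measurable_monomialFun hA k).aestronglyMeasurable (Eventually.of_forall fun p => ?_)
  by_cases h2 : p.1 ∈ A
  · simp [hAI h2]
  · simp [monomialFun, h2]

section Generator

variable (ν : Measure ℝ) [IsProbabilityMeasure ν] [CompactlySupported ν]

/-- `ξ_w`: the word `x_{I₁} ⋯ x_{Iₙ}` corresponds to the vector `χ_{I₁ ∩ ⋯ ∩ Iₙ}(t) x ^ (n - 1)`. -/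
def wordVector (w : Word) : H ν :=
  (memLp_two_monomialFun ν (measurableSet_support w) w.head (support_subset w)
    (w.length - 1)).toLp _

/-- `T_w`: multiplication by the bounded function `χ_{I₁ ∩ ⋯ ∩ Iₙ}(t) x ^ n`. -/
def wordOperator (w : Word) : H ν →ₗ[ℂ] H ν :=
  (((ContinuousLinearMap.mul ℂ ℂ).holderL (timeJump ν) ∞ 2 2)
    ((memLp_top_monomialFun ν (measurableSet_support w) w.length).toLp _)).toLinearMap

/-- `f ↦ ξ_f`, the real-linear extension of `wordVector`. -/
def vector : Poly₀ →ₗ[ℝ] H ν :=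
  Finsupp.linearCombination ℝ (wordVector ν) ∘ₗ (MonoidAlgebra.coeffLinearEquiv ℝ).toLinearMap

/-- `f ↦ T_f`, the real-linear extension of `wordOperator`. -/
def operator : Poly₀ →ₗ[ℝ] (H ν →ₗ[ℂ] H ν) :=
  Finsupp.linearCombination ℝ (wordOperator ν) ∘ₗ (MonoidAlgebra.coeffLinearEquiv ℝ).toLinearMap

end Generator

section Operators

variable (q : Set.Ioo (-1 : ℝ) 1) (ν : Measure ℝ) [IsProbabilityMeasure ν] [CompactlySupported ν]

/-- `X(f) = p(ξ_f, T_f)`, as an operator on its invariant dense domain, the algebraic `q`-Fock space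
over `L²(ℝ₊ × ℝ, dt ⊗ ν)`. -/
def fieldOperator (f : Poly₀) : Module.End ℂ (Fock (H ν) q) := field (vector ν f) (operator ν f)

/-- The complex algebra generated by all the `X(f)`. -/
def fullAlgebra : Subalgebra ℂ (Module.End ℂ (Fock (H ν) q)) :=
  Algebra.adjoin ℂ (Set.range (fieldOperator q ν))

/-- `X(f)` as an element of the algebra. -/
def XPoly (f : Poly₀) : fullAlgebra q ν :=
  ⟨fieldOperator q ν f, Algebra.subset_adjoin ⟨f, rfl⟩⟩

/-- `Y_k(I) = X(x_I ^ k)`, for `k ≥ 1`. -/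
def Y (k : ℕ) (I : Interval) : fullAlgebra q ν := XPoly q ν (.single (powWord I k) 1)

/-- The increment `X(I) = Y_1(I)` of the process. -/
def X (I : Interval) : fullAlgebra q ν := Y q ν 1 I

/-- The subalgebra at time `t`, generated by the `Y_k(s)` with `k ≥ 1` and `s ≤ t`. -/
def algebraUpTo (t : ℝ≥0) : Subalgebra ℂ (fullAlgebra q ν) :=
  Algebra.adjoin ℂ {A | ∃ k ≥ 1, ∃ s ≤ t, A = Y q ν k (.upTo s)}

/-- The Wick products `W(ξ_{f₁} ⊗ ⋯ ⊗ ξ_{fₙ})`, given by their recursion. -/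
def wick : List Poly₀ → fullAlgebra q ν
  | [] => 1
  | f :: l => XPoly q ν f * wick l
      - ∑ i : Fin l.length,
          (((q : ℝ) : ℂ) ^ (i : ℕ) * inner ℂ (vector ν f) (vector ν l[i])) • wick (l.eraseIdx i)
      - ∑ i : Fin l.length, (((q : ℝ) : ℂ) ^ (i : ℕ)) • wick (f * l[i] :: l.eraseIdx i)
  termination_by l => l.length
  decreasing_by
    · simp
    · simp [List.length_eraseIdx]
    · have := i.2
      simp [List.length_eraseIdx]; omega

/-- The inner product `⟨A, B⟩_φ = φ(A* B) = ⟨A Ω, B Ω⟩_q` of the vacuum state `φ`. -/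
instance : PreInnerProductSpace.Core ℂ (fullAlgebra q ν) where
  inner A B := inner ℂ ((A : Module.End ℂ (Fock (H ν) q)) (vacuum (H ν) q))
    ((B : Module.End ℂ (Fock (H ν) q)) (vacuum (H ν) q))
  conj_inner_symm _ _ := inner_conj_symm _ _
  re_inner_nonneg _ := inner_self_nonneg
  add_left _ _ _ := inner_add_left _ _ _
  smul_left _ _ _ := inner_smul_left _ _ _

instance : SeminormedAddCommGroup (fullAlgebra q ν) :=
  InnerProductSpace.Core.toSeminormedAddCommGroup (𝕜 := ℂ)

instance : InnerProductSpace ℂ (fullAlgebra q ν) := InnerProductSpace.ofCore _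

/-- `L²(φ)`: the completion of the algebra for the inner product of the vacuum state. -/
abbrev L2 : Type := UniformSpace.Completion (fullAlgebra q ν)

/-- The canonical map of the algebra into `L²(φ)`. -/
def toL2 (A : fullAlgebra q ν) : L2 q ν := (A : UniformSpace.Completion (fullAlgebra q ν))

end Operators

/-! ### Stochastic integrals -/

/-- Subdivisions of `I = [u, v)` into intervals `[t_i, t_{i+1})`, `u = t_0 < ⋯ < t_N = v`. -/
structure Subdivision (I : Interval) where
  N : ℕ
  pt : Fin (N + 1) → ℝ≥0
  strictMono : StrictMono pt
  first : pt 0 = I.lo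
  last : pt (Fin.last N) = I.hi

namespace Subdivision

variable {I : Interval}

/-- The `i`-th interval of the subdivision. -/
def part (P : Subdivision I) (i : Fin P.N) : Interval :=
  ⟨P.pt i.castSucc, P.pt i.succ, (P.strictMono i.castSucc_lt_succ).le⟩

/-- `δ(P)`, the largest length of the intervals of `P`. -/
def mesh (P : Subdivision I) : ℝ := ⨆ i, (P.part i).length

end Subdivision

/-- The filter of subdivisions `P` of `I` with `δ(P) → 0`. -/
def meshFilter (I : Interval) : Filter (Subdivision I) := comap Subdivision.mesh (𝓝 0)

section Integrals

variable (q : Set.Ioo (-1 : ℝ) 1) (ν : Measure ℝ) [IsProbabilityMeasure ν] [CompactlySupported ν]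

/-- `∑ X(I_i) U X(I_i)` over the intervals of a subdivision. -/
def sandwichSum {I : Interval} (U : fullAlgebra q ν) (P : Subdivision I) : fullAlgebra q ν :=
  ∑ i, X q ν (P.part i) * U * X q ν (P.part i)

/-- `L` is the integral `∫ dX(t) χ_I(t) U dX(t)`, the limit in `L²(φ)` of the sums
`∑ X(I_i) U X(I_i)`. -/
def HasSandwichIntegral (I : Interval) (U : fullAlgebra q ν) (L : L2 q ν) : Prop :=
  Tendsto (fun P : Subdivision I => toL2 q ν (sandwichSum q ν U P)) (meshFilter I) (𝓝 L)

/-- The elementary process `χ_I(t) U`. -/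
def elementary (I : Interval) (U : fullAlgebra q ν) : ℝ≥0 → fullAlgebra q ν :=
  (Set.Ico I.lo I.hi).indicator fun _ => U

/-- The simple adapted algebraic processes: finite sums of processes `χ_{[a, b)}(t) U` with `U` in
the algebra at time `a`. -/
def simpleAdapted : Submodule ℂ (ℝ≥0 → fullAlgebra q ν) :=
  Submodule.span ℂ {V | ∃ I : Interval, ∃ U ∈ algebraUpTo q ν I.lo, V = elementary q ν I U}

theorem elementary_mem {I : Interval} {U : fullAlgebra q ν} (hU : U ∈ algebraUpTo q ν I.lo) :
    elementary q ν I U ∈ simpleAdapted q ν :=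
  Submodule.subset_span ⟨I, U, hU, rfl⟩

/-- `J` is the linear extension `V ↦ ∫ dX(t) V(t) dX(t)` to simple adapted algebraic processes. -/
def IsSandwichIntegral (J : simpleAdapted q ν →ₗ[ℂ] L2 q ν) : Prop :=
  ∀ (I : Interval) (U : fullAlgebra q ν) (hU : U ∈ algebraUpTo q ν I.lo),
    HasSandwichIntegral q ν I U (J ⟨elementary q ν I U, elementary_mem q ν hU⟩)

/-- `Δ t` is the diagonal measure `Δ_k(t) = ∫_0^t (dX)^k`, the limit in `L²(φ)` of the sums
`∑ X(I_i) ^ k` over subdivisions of `[0, t)`. -/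
def IsDiagonalMeasure (k : ℕ) (Δ : ℝ≥0 → fullAlgebra q ν) : Prop :=
  ∀ t, Tendsto (fun P : Subdivision (.upTo t) => toL2 q ν (∑ i, X q ν (P.part i) ^ k))
    (meshFilter (.upTo t)) (𝓝 (toL2 q ν (Δ t)))

/-- `Γ` is the second quantization `Γ_q(q)` of `q Id`. -/
def IsSecondQuantization (Γ : fullAlgebra q ν →ₗ[ℂ] fullAlgebra q ν) : Prop :=
  ∀ l : List Poly₀, Γ (wick q ν l) = ((q : ℝ) : ℂ) ^ l.length • wick q ν l

/-- The left Itô integral `∫ dZ(t) V(t)` of the simple process `V = ∑ χ_{I_i}(t) V_i`. -/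
def leftIntegral (Z : ℝ≥0 → fullAlgebra q ν) {n : ℕ} (I : Fin n → Interval)
    (V : Fin n → fullAlgebra q ν) : fullAlgebra q ν :=
  ∑ i, (Z (I i).hi - Z (I i).lo) * V i

end Integrals

end QLevy

end

noncomputable section

open scoped TensorProduct DirectSum ENNReal NNReal
open Filter Topology MeasureTheory

set_option linter.unusedSectionVars false

namespace QFock

variable {E : Type*} [NormedAddCommGroup E] [InnerProductSpace ℂ E] {q : Set.Ioo (-1 : ℝ) 1}

/-! ### Comparison of the `q`-norm with the tensor norm -/

theorem abs_re_inner₀_permute_le {n : ℕ} (σ : Equiv.Perm (Fin n)) (w : TPow E n) :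
    |(inner₀ w (permute σ w)).re| ≤ (inner₀ w w).re := by
  have hsub : ∀ c : ℂ, 0 ≤ (inner₀ (w + c • permute σ w) (w + c • permute σ w)).re :=
    fun c => inner₀_self_nonneg _
  have hsymm : (inner₀ (permute σ w) w).re = (inner₀ w (permute σ w)).re := by
    rw [← inner₀_symm]; simp
  have h1 := hsub 1
  have h2 := hsub (-1)
  simp only [inner₀_add_left, inner₀_add_right, inner₀_smul_left, inner₀_smul_right,
    inner₀_permute, star_one, star_neg, Complex.add_re, one_mul, neg_mul, Complex.neg_re, hsymm] at h1 h2
  rw [abs_le]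
  constructor <;> linarith

theorem re_innerq_self_le {n : ℕ} {q : ℝ} (hq : q ∈ Set.Ioo (-1 : ℝ) 1) (w : TPow E n) :
    (innerq q w w).re ≤ n.factorial * (inner₀ w w).re := by
  have h : (innerq q w w).re
      = ∑ σ : Equiv.Perm (Fin n), q ^ inversions σ * (inner₀ w (permute σ w)).re := by
    simp only [innerq, symmetrizer, ← innerₗ_apply, LinearMap.sum_apply, map_sum,
      LinearMap.smul_apply, map_smul, smul_eq_mul, Complex.re_sum]
    refine Finset.sum_congr rfl fun σ _ => ?_
    rw [← Complex.ofReal_pow, Complex.re_ofReal_mul]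
  rw [h]
  calc _ ≤ ∑ _σ : Equiv.Perm (Fin n), (inner₀ w w).re := by
        refine Finset.sum_le_sum fun σ _ => (le_abs_self _).trans ?_
        rw [abs_mul, abs_pow]
        calc _ ≤ 1 * |(inner₀ w (permute σ w)).re| :=
              mul_le_mul_of_nonneg_right
                (pow_le_one₀ (abs_nonneg _) (abs_le.mpr ⟨hq.1.le, hq.2.le⟩)) (abs_nonneg _)
          _ ≤ _ := by rw [one_mul]; exact abs_re_inner₀_permute_le σ w
    _ = _ := by simp [Fintype.card_perm]

theorem norm_particles_sq_le {n : ℕ} (w : TPow E n) :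
    ‖particles q n w‖ ^ 2 ≤ n.factorial * (inner₀ w w).re := by
  rw [← inner_self_eq_norm_sq (𝕜 := ℂ)]
  change (fockInner _ _).re ≤ _
  rw [fockInner, fromParticles_particles, LinearMap.comp_apply, component_particles, innerₗ_apply]
  exact re_innerq_self_le q.2 w

/-- Sums of elementary tensors that are pairwise orthogonal in a common slot. -/
theorem norm_sum_tensor_sq_le {ι : Type*} {n : ℕ} (s : Finset ι) (c : ι → ℂ) (ζ : ι → Fin n → E)
    (h : ∀ i ∈ s, ∀ j ∈ s, i ≠ j → ∃ k, inner ℂ (ζ i k) (ζ j k) = 0) :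
    ‖∑ i ∈ s, c i • tensor q (ζ i)‖ ^ 2
      ≤ n.factorial * ∑ i ∈ s, ‖c i‖ ^ 2 * ∏ k, ‖ζ i k‖ ^ 2 := by
  have h1 : ∑ i ∈ s, c i • tensor q (ζ i)
      = particles q n (∑ i ∈ s, c i • PiTensorProduct.tprod ℂ (ζ i)) := by
    simp [tensor]
  rw [h1]
  refine (norm_particles_sq_le _).trans (le_of_eq ?_)
  congr 1
  rw [inner₀_sum_sum, Complex.re_sum]
  refine Finset.sum_congr rfl fun i hi => ?_
  rw [Finset.sum_eq_single_of_mem i hi]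
  · rw [inner₀_smul_left, inner₀_smul_right, inner₀_tprod, ← mul_assoc]
    have h2 : star (c i) * c i = ((‖c i‖ ^ 2 : ℝ) : ℂ) := by
      simpa using RCLike.conj_mul (c i)
    have h3 : ∏ k, inner ℂ (ζ i k) (ζ i k) = ((∏ k, ‖ζ i k‖ ^ 2 : ℝ) : ℂ) := by
      rw [Complex.ofReal_prod]
      refine Finset.prod_congr rfl fun k _ => ?_
      simp
    rw [h2, h3, ← Complex.ofReal_mul, Complex.ofReal_re]
  · intro j hj hji
    obtain ⟨k, hk⟩ := h i hi j hj hji.symm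
    rw [inner₀_smul_left, inner₀_smul_right, inner₀_tprod,
      Finset.prod_eq_zero (Finset.mem_univ k) hk]
    simp

/-! ### Linear maps out of the Fock space -/

theorem fock_hom_ext {F : Type*} [AddCommGroup F] [Module ℂ F] {f g : Fock E q →ₗ[ℂ] F}
    (h : ∀ (n : ℕ) (η : Fin n → E), f (tensor q η) = g (tensor q η)) : f = g := by
  refine DirectSum.linearMap_ext ℂ fun n => ?_
  refine PiTensorProduct.ext (MultilinearMap.ext fun η => ?_)
  exact h n η

theorem fock_hom_ext_succ {F : Type*} [AddCommGroup F] [Module ℂ F] {f g : Fock E q →ₗ[ℂ] F}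
    (h0 : f (vacuum E q) = g (vacuum E q))
    (h : ∀ (n : ℕ) (η : Fin (n + 1) → E), f (tensor q η) = g (tensor q η)) : f = g := by
  refine fock_hom_ext fun n η => ?_
  cases n with
  | zero => rwa [Subsingleton.elim η Fin.elim0]
  | succ n => exact h n η

theorem tensor_update_add {n : ℕ} (η : Fin n → E) (k : Fin n) (x y : E) :
    tensor q (Function.update η k (x + y))
      = tensor q (Function.update η k x) + tensor q (Function.update η k y) := by
  simp [tensor]

theorem tensor_update_smul {n : ℕ} (η : Fin n → E) (k : Fin n) (c : ℂ) (x : E) :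
    tensor q (Function.update η k (c • x)) = c • tensor q (Function.update η k x) := by
  simp [tensor]

variable (q) in
/-- The elementary tensor with a variable `k`-th factor, as a linear map. -/
def tensorUpdate {n : ℕ} (η : Fin n → E) (k : Fin n) : E →ₗ[ℂ] Fock E q where
  toFun x := tensor q (Function.update η k x)
  map_add' := tensor_update_add η k
  map_smul' := tensor_update_smul η k

theorem tensorUpdate_apply {n : ℕ} (η : Fin n → E) (k : Fin n) (x : E) :
    tensorUpdate q η k x = tensor q (Function.update η k x) := rfl

/-- `ζ ↦ a*(ζ)` as a linear map. -/
def creationₗ : E →ₗ[ℂ] Fock E q →ₗ[ℂ] Fock E q where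
  toFun := creation
  map_add' x y := fock_hom_ext fun n η => by
    simp only [LinearMap.add_apply, creation_tensor]
    simpa using tensor_update_add (q := q) (Fin.cons 0 η : Fin (n + 1) → E) 0 x y
  map_smul' c x := fock_hom_ext fun n η => by
    simp only [LinearMap.smul_apply, creation_tensor, RingHom.id_apply]
    simpa using tensor_update_smul (q := q) (Fin.cons 0 η : Fin (n + 1) → E) 0 c x

theorem creationₗ_apply (ζ : E) : creationₗ (q := q) ζ = creation ζ := rfl

theorem creation_add (x y : E) : creation (q := q) (x + y) = creation x + creation y :=
  map_add creationₗ x y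

theorem creation_smul (c : ℂ) (x : E) : creation (q := q) (c • x) = c • creation x :=
  map_smul creationₗ c x

theorem creation_sum {ι : Type*} (s : Finset ι) (x : ι → E) :
    creation (q := q) (∑ i ∈ s, x i) = ∑ i ∈ s, creation (x i) := map_sum creationₗ x s

theorem annihilation_add (x y : E) :
    annihilation (q := q) (x + y) = annihilation x + annihilation y := by
  refine fock_hom_ext_succ (by simp [annihilation_vacuum]) fun n η => ?_
  simp only [LinearMap.add_apply, annihilation_tensor, inner_add_left, mul_add, add_smul,
    Finset.sum_add_distrib]

theorem annihilation_smul (c : ℂ) (x : E) :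
    annihilation (q := q) (c • x) = star c • annihilation x := by
  refine fock_hom_ext_succ (by simp [annihilation_vacuum]) fun n η => ?_
  simp only [LinearMap.smul_apply, annihilation_tensor, inner_smul_left, Finset.smul_sum,
    smul_smul, mul_left_comm, Complex.star_def]

theorem gauge_add (S T : E →ₗ[ℂ] E) : gauge (q := q) (S + T) = gauge S + gauge T := by
  refine fock_hom_ext_succ (by simp [gauge_vacuum]) fun n η => ?_
  simp only [gauge_tensor, LinearMap.add_apply, ← creation_tensor, creation_add, smul_add,
    Finset.sum_add_distrib]

theorem gauge_smul (c : ℂ) (T : E →ₗ[ℂ] E) : gauge (q := q) (c • T) = c • gauge T := by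
  refine fock_hom_ext_succ (by simp [gauge_vacuum]) fun n η => ?_
  simp only [gauge_tensor, LinearMap.smul_apply, ← creation_tensor, creation_smul,
    Finset.smul_sum, smul_comm c]

theorem field_add (x y : E) (S T : E →ₗ[ℂ] E) :
    field (q := q) (x + y) (S + T) = field x S + field y T := by
  simp only [field, annihilation_add, creation_add, gauge_add]; abel

theorem field_real_smul (c : ℝ) (x : E) (T : E →ₗ[ℂ] E) :
    field (q := q) ((c : ℂ) • x) ((c : ℂ) • T) = (c : ℂ) • field x T := by
  simp only [field, annihilation_smul, creation_smul, gauge_smul, smul_add, Complex.star_def,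
    Complex.conj_ofReal]

theorem field_vacuum (ζ : E) (T : E →ₗ[ℂ] E) :
    field ζ T (vacuum E q) = creation ζ (vacuum E q) := by
  simp [field, annihilation_vacuum, gauge_vacuum]

/-! ### The operator `q ^ N` and the right creation operators -/

variable (E q) in
/-- The operator equal to `q ^ n` on the `n`-particle space. -/
def qPowNumber : Fock E q →ₗ[ℂ] Fock E q :=
  fromParticles fun n => (((q : ℝ) : ℂ) ^ n) • particles q n

theorem qPowNumber_tensor {n : ℕ} (η : Fin n → E) :
    qPowNumber E q (tensor q η) = (((q : ℝ) : ℂ) ^ n) • tensor q η := by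
  rw [qPowNumber, tensor, fromParticles_particles, LinearMap.smul_apply]

/-- `η₁ ⊗ ⋯ ⊗ ηₙ ↦ η₁ ⊗ ⋯ ⊗ ηₙ ⊗ ζ`. -/
def rightCreation (ζ : E) : Fock E q →ₗ[ℂ] Fock E q :=
  fromParticles fun n => particles q (n + 1) ∘ₗ PiTensorProduct.lift
    ((LinearMap.applyₗ ζ).compMultilinearMap
      (PiTensorProduct.tprod ℂ (s := fun _ : Fin (n + 1) => E)).curryRight)

theorem rightCreation_tensor (ζ : E) {n : ℕ} (η : Fin n → E) :
    rightCreation ζ (tensor q η) = tensor q (Fin.snoc η ζ : Fin (n + 1) → E) := by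
  rw [rightCreation, tensor, fromParticles_particles, LinearMap.comp_apply,
    PiTensorProduct.lift.tprod]
  rfl

theorem rightCreation_vacuum (ζ : E) :
    rightCreation ζ (vacuum E q) = creation ζ (vacuum E q) := by
  rw [vacuum, rightCreation_tensor, creation_tensor]
  congr 1
  funext i
  rw [Fin.fin_one_eq_zero i]
  rfl

theorem removeNth_castSucc_snoc {α : Type*} {n : ℕ} (k : Fin (n + 1)) (η : Fin (n + 1) → α)
    (z : α) : (Fin.castSucc k).removeNth (Fin.snoc η z : Fin (n + 2) → α)
      = (Fin.snoc (k.removeNth η) z : Fin (n + 1) → α) := by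
  funext i
  refine Fin.lastCases ?_ (fun i => ?_) i
  · simp [Fin.removeNth]
  · simp [Fin.removeNth, Fin.castSucc_succAbove_castSucc]

/-- The commutation relation of the left fields with the right creation operators. -/
theorem field_rightCreation (ζ : E) (T : E →ₗ[ℂ] E) (z : E) (v : Fock E q) :
    field ζ T (rightCreation z v) = rightCreation z (field ζ T v)
      + (inner ℂ ζ z • qPowNumber E q v + creation (T z) (qPowNumber E q v)) := by
  suffices h : field ζ T ∘ₗ rightCreation z = rightCreation z ∘ₗ field ζ T
      + (inner ℂ ζ z • qPowNumber E q + creation (T z) ∘ₗ qPowNumber E q) from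
    LinearMap.congr_fun h v
  refine fock_hom_ext fun n η => ?_
  simp only [LinearMap.comp_apply, LinearMap.add_apply, LinearMap.smul_apply, field,
    rightCreation_tensor, annihilation_tensor, gauge_tensor, creation_tensor, qPowNumber_tensor,
    map_smul, map_add, Fin.sum_univ_castSucc, Fin.snoc_last, Fin.snoc_castSucc, Fin.val_last,
    Fin.val_castSucc, Fin.removeNth_last, Fin.init_snoc, smul_smul]
  cases n with
  | zero =>
    have h0 : η = Fin.elim0 := Subsingleton.elim _ _
    have hs : (Fin.cons ζ (Fin.snoc η z : Fin 1 → E) : Fin 2 → E)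
        = (Fin.snoc (Fin.cons ζ η : Fin 1 → E) z : Fin 2 → E) := by
      rw [← Fin.cons_snoc_eq_snoc_cons]
    subst h0
    have ha : annihilation ζ (tensor q (Fin.elim0 : Fin 0 → E)) = 0 := annihilation_vacuum ζ
    have hg : gauge T (tensor q (Fin.elim0 : Fin 0 → E)) = 0 := gauge_vacuum T
    simp only [ha, hg, hs, map_zero]
    simp
    abel
  | succ n =>
    simp only [annihilation_tensor, gauge_tensor, map_sum, map_smul, rightCreation_tensor,
      removeNth_castSucc_snoc, Fin.cons_snoc_eq_snoc_cons, mul_comm (inner ℂ ζ z)]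
    abel

/-! ### Elementary tensors indexed by lists -/

variable (q) in
/-- The elementary tensor of a list of vectors. -/
def listTensor (l : List E) : Fock E q := tensor q l.get

theorem listTensor_eq {n : ℕ} {l : List E} (h : l.length = n) {η : Fin n → E}
    (hη : ∀ i (hi : i < l.length), l[i] = η ⟨i, h ▸ hi⟩) : listTensor q l = tensor q η := by
  subst h
  exact congrArg _ (funext fun i : Fin l.length => hη i i.2)

theorem listTensor_nil : listTensor q ([] : List E) = vacuum E q :=
  listTensor_eq rfl fun i hi => by simp at hi

theorem creation_listTensor (ζ : E) (l : List E) :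
    creation ζ (listTensor q l) = listTensor q (ζ :: l) := by
  rw [listTensor, creation_tensor]
  exact (listTensor_eq (l := ζ :: l) rfl fun i _ => by
    cases i <;> rfl).symm

theorem listTensor_eraseIdx (l : List E) {n : ℕ} (h : l.length = n + 1) (k : Fin (n + 1)) :
    listTensor q (l.eraseIdx k) = tensor q (k.removeNth fun i : Fin (n + 1) => l[(i : ℕ)]) := by
  refine listTensor_eq (by rw [List.length_eraseIdx_of_lt (by omega)]; omega) fun i hi => ?_
  simp only [List.getElem_eraseIdx, Fin.removeNth, Fin.succAbove, Fin.lt_def, Fin.val_castSucc]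
  split_ifs <;> rfl

theorem annihilation_listTensor (ζ : E) (l : List E) :
    annihilation ζ (listTensor q l) = ∑ k : Fin l.length,
      (((q : ℝ) : ℂ) ^ (k : ℕ) * inner ℂ ζ l[k]) • listTensor q (l.eraseIdx k) := by
  cases l with
  | nil => rw [listTensor_nil, annihilation_vacuum]; simp
  | cons a l =>
    rw [listTensor, annihilation_tensor]
    refine Finset.sum_congr rfl fun k _ => ?_
    rw [listTensor_eraseIdx (a :: l) rfl k]
    rfl

theorem gauge_listTensor (T : E →ₗ[ℂ] E) (l : List E) :
    gauge T (listTensor q l) = ∑ k : Fin l.length,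
      (((q : ℝ) : ℂ) ^ (k : ℕ)) • listTensor q (T l[k] :: l.eraseIdx k) := by
  cases l with
  | nil => rw [listTensor_nil, gauge_vacuum]; simp
  | cons a l =>
    rw [listTensor, gauge_tensor]
    refine Finset.sum_congr rfl fun k _ => ?_
    rw [← creation_listTensor, listTensor_eraseIdx (a :: l) rfl k, creation_tensor]
    rfl

theorem qPowNumber_listTensor (l : List E) :
    qPowNumber E q (listTensor q l) = (((q : ℝ) : ℂ) ^ l.length) • listTensor q l :=
  qPowNumber_tensor _

/-- The tensors of words in a linearly independent family are linearly independent. -/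
theorem linearIndependent_listTensor {ι : Type*} {e : ι → E} (he : LinearIndependent ℂ e) :
    LinearIndependent ℂ fun l : List ι => listTensor q (l.map e) := by
  classical
  obtain ⟨ρ, hρ⟩ := LinearMap.exists_leftInverse_of_injective (Finsupp.linearCombination ℂ e)
    (LinearMap.ker_eq_bot.mpr he)
  have hρe : ∀ b b', ρ (e b) b' = if b = b' then 1 else 0 := by
    intro b b'
    have := LinearMap.congr_fun hρ (Finsupp.single b 1)
    simp only [LinearMap.comp_apply, Finsupp.linearCombination_single, one_smul,
      LinearMap.id_apply] at this
    rw [this, Finsupp.single_apply]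
  let δ : List ι → Fock E q →ₗ[ℂ] ℂ := fun l =>
    PiTensorProduct.dualDistrib (PiTensorProduct.tprod ℂ fun i : Fin l.length =>
      (Finsupp.lapply l[i] ∘ₗ ρ : Module.Dual ℂ E)) ∘ₗ component l.length
  have hδ : ∀ l l' : List ι, δ l (listTensor q (l'.map e)) = if l' = l then 1 else 0 := by
    intro l l'
    by_cases h : l'.length = l.length
    · have h1 : listTensor q (l'.map e) = tensor q fun i : Fin l.length => e l'[i] :=
        listTensor_eq (by simpa using h) fun i hi => by simp
      rw [h1]
      simp only [δ, LinearMap.comp_apply, tensor, component_particles,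
        PiTensorProduct.dualDistrib_apply, Finsupp.lapply_apply, hρe, Fintype.prod_ite_zero,
        Finset.prod_const_one]
      refine if_congr ?_ rfl rfl
      constructor
      · intro h2
        exact List.ext_getElem h fun i hi hi' => h2 ⟨i, hi'⟩
      · rintro rfl i; rfl
    · have h2 : component l.length (listTensor q (l'.map e)) = 0 :=
        component_particles_of_ne (by simpa using h) _
      rw [if_neg fun h' => h (congrArg _ h')]
      simp only [δ, LinearMap.comp_apply, h2, map_zero]
  rw [linearIndependent_iff]
  intro c hc
  ext l
  have := congrArg (δ l) hc
  rw [Finsupp.linearCombination_apply, map_finsuppSum] at this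
  simpa [hδ, Finsupp.sum_ite_eq'] using this

end QFock

namespace QLevy

open QFock

/-! ### Multiplication operators on the one-particle space -/

section Multiplication

variable (ν : Measure ℝ) [CompactlySupported ν]

/-- Multiplication by `χ_A(t) x ^ k`. -/
def mulOp {A : Set ℝ} (hA : MeasurableSet A) (k : ℕ) : H ν →L[ℂ] H ν :=
  ((ContinuousLinearMap.mul ℂ ℂ).holderL (timeJump ν) ∞ 2 2)
    ((memLp_top_monomialFun ν hA k).toLp _)

theorem wordOperator_eq (w : Word) :
    wordOperator ν w = (mulOp ν (measurableSet_support w) w.length).toLinearMap := rfl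

variable {ν}

theorem coeFn_mulOp {A : Set ℝ} (hA : MeasurableSet A) (k : ℕ) (f : H ν) :
    mulOp ν hA k f =ᵐ[timeJump ν] fun p => monomialFun A k p * f p := by
  have h1 := (ContinuousLinearMap.mul ℂ ℂ).coeFn_holder (r := 2)
    ((memLp_top_monomialFun ν hA k).toLp _) f
  have h2 := (memLp_top_monomialFun ν hA k).coeFn_toLp
  filter_upwards [h1, h2] with p h1 h2
  rw [← h2]
  exact h1

theorem monomialFun_mul (A B : Set ℝ) (k l : ℕ) (p : ℝ × ℝ) :
    monomialFun A k p * monomialFun B l p = monomialFun (A ∩ B) (k + l) p := by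
  by_cases h1 : p.1 ∈ A <;> by_cases h2 : p.1 ∈ B <;> simp [monomialFun, h1, h2, pow_add]

theorem conj_monomialFun (A : Set ℝ) (k : ℕ) (p : ℝ × ℝ) :
    (starRingEnd ℂ) (monomialFun A k p) = monomialFun A k p := by
  by_cases h1 : p.1 ∈ A <;> simp [monomialFun, h1]

theorem mulOp_mulOp {A B : Set ℝ} (hA : MeasurableSet A) (hB : MeasurableSet B) (k l : ℕ)
    (f : H ν) : mulOp ν hA k (mulOp ν hB l f) = mulOp ν (hA.inter hB) (k + l) f := by
  refine Lp.ext ?_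
  filter_upwards [coeFn_mulOp hA k (mulOp ν hB l f), coeFn_mulOp hB l f,
    coeFn_mulOp (hA.inter hB) (k + l) f] with p h1 h2 h3
  rw [h1, h2, h3, ← mul_assoc, monomialFun_mul]

theorem mulOp_congr {A B : Set ℝ} (hA : MeasurableSet A) {hB : MeasurableSet B} {k l : ℕ}
    (h : A = B) (h' : k = l) : mulOp ν hA k = mulOp ν hB l := by
  subst h h'; rfl

theorem mulOp_comm {A B : Set ℝ} (hA : MeasurableSet A) (hB : MeasurableSet B) (k l : ℕ)
    (f : H ν) : mulOp ν hA k (mulOp ν hB l f) = mulOp ν hB l (mulOp ν hA k f) := by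
  rw [mulOp_mulOp, mulOp_mulOp, mulOp_congr _ (Set.inter_comm A B) (add_comm k l)]

theorem inner_mulOp {A : Set ℝ} (hA : MeasurableSet A) (k : ℕ) (f g : H ν) :
    inner ℂ (mulOp ν hA k f) g = inner ℂ f (mulOp ν hA k g) := by
  rw [L2.inner_def, L2.inner_def]
  refine integral_congr_ae ?_
  filter_upwards [coeFn_mulOp hA k f, coeFn_mulOp hA k g] with p h1 h2
  rw [h1, h2, RCLike.inner_apply, RCLike.inner_apply, map_mul, conj_monomialFun]
  ring

theorem mulOp_empty (k : ℕ) : mulOp ν MeasurableSet.empty k = 0 := by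
  ext1 f
  refine Lp.ext ?_
  filter_upwards [coeFn_mulOp MeasurableSet.empty k f, Lp.coeFn_zero ℂ 2 (timeJump ν)] with p h1 h2
  rw [h1, zero_apply, h2]
  simp [monomialFun]

theorem mulOp_union {A B : Set ℝ} (hA : MeasurableSet A) (hB : MeasurableSet B)
    (h : Disjoint A B) (k : ℕ) (f : H ν) :
    mulOp ν (hA.union hB) k f = mulOp ν hA k f + mulOp ν hB k f := by
  refine Lp.ext ?_
  filter_upwards [coeFn_mulOp (hA.union hB) k f, coeFn_mulOp hA k f, coeFn_mulOp hB k f,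
    Lp.coeFn_add (mulOp ν hA k f) (mulOp ν hB k f)] with p h1 h2 h3 h4
  rw [h1, h4, Pi.add_apply, h2, h3, ← add_mul]
  congr 1
  by_cases h5 : p.1 ∈ A
  · simp [monomialFun, h5, Set.disjoint_left.mp h h5]
  · by_cases h6 : p.1 ∈ B <;> simp [monomialFun, h5, h6]

variable [IsProbabilityMeasure ν]

/-! ### The vectors and operators of polynomials -/

theorem coeFn_wordVector (w : Word) :
    wordVector ν w =ᵐ[timeJump ν] monomialFun (support w) (w.length - 1) :=
  MemLp.coeFn_toLp _

theorem mem_support {w : Word} {t : ℝ} :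
    t ∈ support w ↔ t ∈ w.head.toSet ∧ ∀ J ∈ w.tail, t ∈ J.toSet := Iff.rfl

theorem support_mul (w w' : Word) : support (w * w') = support w ∩ support w' := by
  ext t
  simp only [Set.mem_inter_iff, mem_support, FreeSemigroup.head_mul, FreeSemigroup.tail_mul,
    List.mem_append, List.mem_cons]
  constructor
  · rintro ⟨h1, h2⟩
    exact ⟨⟨h1, fun J hJ => h2 J (Or.inl hJ)⟩, h2 _ (Or.inr (Or.inl rfl)),
      fun J hJ => h2 J (Or.inr (Or.inr hJ))⟩
  · rintro ⟨⟨h1, h2⟩, h3, h4⟩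
    refine ⟨h1, ?_⟩
    rintro J (hJ | rfl | hJ)
    exacts [h2 J hJ, h3, h4 J hJ]

theorem length_pos (w : Word) : 0 < w.length := Nat.succ_pos _

theorem mulOp_wordVector {A : Set ℝ} (hA : MeasurableSet A) (k : ℕ) (w w' : Word)
    (hs : support w' = A ∩ support w) (hl : w'.length = k + w.length) :
    mulOp ν hA k (wordVector ν w) = wordVector ν w' := by
  refine Lp.ext ?_
  filter_upwards [coeFn_mulOp hA k (wordVector ν w), coeFn_wordVector (ν := ν) w,
    coeFn_wordVector (ν := ν) w'] with p h1 h2 h3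
  rw [h1, h2, h3, monomialFun_mul, hs, hl, Nat.add_sub_assoc (length_pos w)]

theorem wordOperator_wordVector (w w' : Word) :
    wordOperator ν w (wordVector ν w') = wordVector ν (w * w') :=
  mulOp_wordVector (measurableSet_support w) _ _ _ (support_mul w w') (FreeSemigroup.length_mul w w')

theorem vector_single (w : Word) (r : ℝ) :
    vector ν (.single w r) = (r : ℂ) • wordVector ν w := by
  rw [vector, LinearMap.comp_apply]
  refine (Finsupp.linearCombination_single ℝ r w).trans ?_
  exact RCLike.real_smul_eq_coe_smul (K := ℂ) r _

theorem operator_single (w : Word) (r : ℝ) :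
    operator ν (.single w r) = (r : ℂ) • wordOperator ν w := by
  rw [operator, LinearMap.comp_apply]
  refine (Finsupp.linearCombination_single ℝ r w).trans ?_
  exact LinearMap.ext fun x => RCLike.real_smul_eq_coe_smul (K := ℂ) r _

theorem operator_vector (f g : Poly₀) : operator ν f (vector ν g) = vector ν (f * g) := by
  induction f using MonoidAlgebra.induction_linear with
  | zero => simp
  | add f f' hf hf' => simp only [map_add, LinearMap.add_apply, hf, hf', add_mul]
  | single w r =>
    induction g using MonoidAlgebra.induction_linear with
    | zero => simp
    | add g g' hg hg' => simp only [map_add, hg, hg', mul_add]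
    | single w' s =>
      rw [MonoidAlgebra.single_mul_single, vector_single, vector_single, operator_single,
        LinearMap.smul_apply, map_smul, wordOperator_wordVector, smul_smul, Complex.ofReal_mul]

theorem conj_inner_vector (f g : Poly₀) :
    (starRingEnd ℂ) (inner ℂ (vector ν f) (vector ν g)) = inner ℂ (vector ν f) (vector ν g) := by
  induction f using MonoidAlgebra.induction_linear with
  | zero => simp
  | add f f' hf hf' => simp only [map_add, inner_add_left, hf, hf']
  | single w r =>
    induction g using MonoidAlgebra.induction_linear with
    | zero => simp
    | add g g' hg hg' => simp only [map_add, inner_add_right, hg, hg']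
    | single w' s =>
      rw [vector_single, vector_single, inner_smul_left, inner_smul_right, map_mul, map_mul,
        Complex.conj_ofReal, Complex.conj_ofReal, L2.inner_def, ← integral_conj]
      refine congrArg₂ _ rfl (congrArg₂ _ (Complex.conj_ofReal s) (integral_congr_ae ?_))
      filter_upwards [coeFn_wordVector (ν := ν) w, coeFn_wordVector (ν := ν) w'] with p h1 h2
      rw [h1, h2, RCLike.inner_apply, map_mul, conj_monomialFun, conj_monomialFun]
      simp [conj_monomialFun]

/-- The bounded operators commuting with the multiplication operators. -/
def multiplierCommutant (ν : Measure ℝ) [CompactlySupported ν] :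
    Submodule ℂ (H ν →L[ℂ] H ν) where
  carrier := {T | ∀ (A : Set ℝ) (hA : MeasurableSet A) (k : ℕ) (f : H ν),
    T (mulOp ν hA k f) = mulOp ν hA k (T f)}
  add_mem' hS hT A hA k f := by simp [hS A hA k f, hT A hA k f]
  zero_mem' A hA k f := by simp
  smul_mem' c T hT A hA k f := by simp [hT A hA k f]

theorem exists_operator_eq (f : Poly₀) :
    ∃ T ∈ multiplierCommutant ν, operator ν f = T.toLinearMap := by
  induction f using MonoidAlgebra.induction_linear with
  | zero => exact ⟨0, zero_mem _, by simp⟩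
  | add f f' hf hf' =>
    obtain ⟨S, hS, h⟩ := hf
    obtain ⟨T, hT, h'⟩ := hf'
    exact ⟨S + T, add_mem hS hT, by rw [map_add, h, h']; rfl⟩
  | single w r =>
    refine ⟨(r : ℂ) • mulOp ν (measurableSet_support w) w.length, Submodule.smul_mem _ _ ?_, ?_⟩
    · intro A hA k f; exact mulOp_comm _ _ _ _ _
    · rw [operator_single, wordOperator_eq]; rfl

theorem comp_mem_multiplierCommutant {S T : H ν →L[ℂ] H ν} (hS : S ∈ multiplierCommutant ν)
    (hT : T ∈ multiplierCommutant ν) : S ∘L T ∈ multiplierCommutant ν := by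
  intro A hA k f
  simp only [ContinuousLinearMap.comp_apply, hT A hA k f, hS A hA k]

end Multiplication

/-! ### Restriction to intervals -/

theorem Interval.length_nonneg (J : Interval) : 0 ≤ J.length :=
  sub_nonneg.mpr (NNReal.coe_le_coe.mpr J.le)

theorem measurableSet_toSet (I : Interval) : MeasurableSet I.toSet := measurableSet_Ico

theorem support_powWord (I : Interval) (k : ℕ) : support (powWord I k) = I.toSet := by
  ext t
  simp [mem_support, powWord, List.mem_replicate]
  intro h _; exact h

theorem length_powWord (I : Interval) {k : ℕ} (hk : 1 ≤ k) : (powWord I k).length = k := by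
  simp [powWord, FreeSemigroup.length]; omega

theorem disjoint_upTo {s : ℝ≥0} {J : Interval} (h : s ≤ J.lo) :
    Disjoint (Interval.upTo s).toSet J.toSet := by
  rw [Set.disjoint_left]
  intro t h1 h2
  exact absurd (h1.2.trans_le ((NNReal.coe_le_coe.mpr h).trans h2.1)) (lt_irrefl _)

section Restriction

variable {ν : Measure ℝ} [IsProbabilityMeasure ν] [CompactlySupported ν]

variable (ν) in
/-- Multiplication by `χ_I(t) x ^ k`. -/
def restr (I : Interval) (k : ℕ) : H ν →L[ℂ] H ν := mulOp ν (measurableSet_toSet I) k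

variable (ν) in
/-- The vector `χ_I(t) x ^ k`. -/
def intervalVector (I : Interval) (k : ℕ) : H ν := wordVector ν (powWord I (k + 1))

theorem operator_powWord (I : Interval) {k : ℕ} (hk : 1 ≤ k) :
    operator ν (.single (powWord I k) 1) = (restr ν I k).toLinearMap := by
  rw [operator_single, Complex.ofReal_one, one_smul, wordOperator_eq, restr,
    mulOp_congr _ (support_powWord I k) (length_powWord I hk)]

theorem vector_powWord (I : Interval) (k : ℕ) :
    vector ν (.single (powWord I (k + 1)) 1) = intervalVector ν I k := by
  rw [vector_single, Complex.ofReal_one, one_smul, intervalVector]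

theorem restr_intervalVector {I J : Interval} (h : J.toSet ⊆ I.toSet) (k l : ℕ) :
    restr ν J k (intervalVector ν I l) = intervalVector ν J (k + l) := by
  refine mulOp_wordVector _ _ _ _ ?_ ?_
  · rw [support_powWord, support_powWord, Set.inter_eq_left.mpr h]
  · rw [length_powWord _ (by omega), length_powWord _ (by omega), add_assoc]

theorem norm_intervalVector_sq (I : Interval) : ‖intervalVector ν I 0‖ ^ 2 = I.length := by
  have h1 : monomialFun I.toSet 0 = (I.toSet ×ˢ Set.univ).indicator fun _ : ℝ × ℝ => (1 : ℂ) := by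
    funext p
    by_cases h : p.1 ∈ I.toSet <;> simp [monomialFun, h]
  have hpos : I.toSet ∩ Set.Ici 0 = I.toSet :=
    Set.inter_eq_left.mpr fun t ht => I.lo.2.trans ht.1
  have hvol : timeJump ν (I.toSet ×ˢ Set.univ) = ENNReal.ofReal I.length := by
    rw [timeJump, Measure.prod_prod, measure_univ, mul_one,
      Measure.restrict_apply (measurableSet_toSet I), hpos]
    exact Real.volume_Ico
  have hm : MeasurableSet (I.toSet ×ˢ (Set.univ : Set ℝ)) :=
    (measurableSet_toSet I).prod MeasurableSet.univ
  have h2 : intervalVector ν I 0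
      = indicatorConstLp 2 hm (by rw [hvol]; exact ENNReal.ofReal_ne_top) (1 : ℂ) := by
    refine Lp.ext ?_
    filter_upwards [coeFn_wordVector (ν := ν) (powWord I 1), indicatorConstLp_coeFn (p := 2)
      (hs := hm) (hμs := by rw [hvol]; exact ENNReal.ofReal_ne_top) (c := (1 : ℂ))] with p h3 h4
    rw [h4, intervalVector, h3, support_powWord, ← h1]
    rfl
  have hlen : 0 ≤ I.length := sub_nonneg.mpr (NNReal.coe_le_coe.mpr I.le)
  rw [h2, norm_indicatorConstLp (by norm_num) (by norm_num), norm_one, one_mul, measureReal_def,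
    hvol, ENNReal.toReal_ofReal hlen, ← Real.rpow_natCast, ← Real.rpow_mul hlen]
  norm_num

theorem inner_intervalVector (I : Interval) :
    inner ℂ (intervalVector ν I 0) (intervalVector ν I 0) = (I.length : ℂ) := by
  rw [inner_self_eq_norm_sq_to_K, ← norm_intervalVector_sq (ν := ν) I]
  norm_cast

theorem restr_restr_of_disjoint {I J : Interval} (h : Disjoint I.toSet J.toSet) (k l : ℕ)
    (f : H ν) : restr ν I k (restr ν J l f) = 0 := by
  rw [restr, restr, mulOp_mulOp,
    mulOp_congr (hB := .empty) _ (Set.disjoint_iff_inter_eq_empty.mp h) rfl,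
    mulOp_empty, zero_apply]

theorem inner_restr_restr_of_disjoint {I J : Interval} (h : Disjoint I.toSet J.toSet) (k l : ℕ)
    (f g : H ν) : inner ℂ (restr ν I k f) (restr ν J l g) = 0 := by
  rw [restr, inner_mulOp, ← restr, restr_restr_of_disjoint h, inner_zero_right]

theorem restr_restr_self (I : Interval) (k l : ℕ) (f : H ν) :
    restr ν I k (restr ν I l f) = restr ν I (k + l) f := by
  rw [restr, restr, mulOp_mulOp, restr, mulOp_congr _ (Set.inter_self _) rfl]

theorem restr_upTo_hi (I : Interval) (k : ℕ) (f : H ν) :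
    restr ν (.upTo I.hi) k f = restr ν (.upTo I.lo) k f + restr ν I k f := by
  have hu : (Interval.upTo I.hi).toSet = (Interval.upTo I.lo).toSet ∪ I.toSet :=
    (Set.Ico_union_Ico_eq_Ico I.lo.2 (NNReal.coe_le_coe.mpr I.le)).symm
  rw [restr, restr, restr, mulOp_congr (measurableSet_toSet (.upTo I.hi))
    (hB := (measurableSet_toSet (.upTo I.lo)).union (measurableSet_toSet I)) hu rfl,
    mulOp_union _ _ (disjoint_upTo le_rfl)]

end Restriction

/-! ### Subdivisions -/

namespace Subdivision

variable {I : Interval}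

theorem part_lo (P : Subdivision I) (i : Fin P.N) : (P.part i).lo = P.pt i.castSucc := rfl

theorem part_hi (P : Subdivision I) (i : Fin P.N) : (P.part i).hi = P.pt i.succ := rfl

theorem lo_le_part (P : Subdivision I) (i : Fin P.N) : I.lo ≤ (P.part i).lo := by
  rw [← P.first]; exact P.strictMono.monotone (Fin.zero_le _)

theorem part_le_hi (P : Subdivision I) (i : Fin P.N) : (P.part i).hi ≤ I.hi := by
  rw [← P.last]; exact P.strictMono.monotone (Fin.le_last _)

theorem part_subset (P : Subdivision I) (i : Fin P.N) : (P.part i).toSet ⊆ I.toSet :=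
  Set.Ico_subset_Ico (NNReal.coe_le_coe.mpr (P.lo_le_part i))
    (NNReal.coe_le_coe.mpr (P.part_le_hi i))

theorem disjoint_part (P : Subdivision I) {i j : Fin P.N} (h : i ≠ j) :
    Disjoint (P.part i).toSet (P.part j).toSet := by
  wlog hij : i < j generalizing i j
  · exact (this h.symm (lt_of_le_of_ne (not_lt.mp hij) h.symm)).symm
  rw [Set.disjoint_left]
  intro t h1 h2
  have h3 : P.pt i.succ ≤ P.pt j.castSucc := P.strictMono.monotone (by
    rw [Fin.le_def, Fin.val_succ, Fin.val_castSucc]; exact hij)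
  exact absurd (h1.2.trans_le ((NNReal.coe_le_coe.mpr h3).trans h2.1)) (lt_irrefl _)

theorem sum_sub {M : Type*} [AddCommGroup M] (F : ℝ≥0 → M) (P : Subdivision I) :
    ∑ i, (F (P.part i).hi - F (P.part i).lo) = F I.hi - F I.lo := by
  rw [← P.first, ← P.last]
  simp only [part_lo, part_hi]
  have h1 := Fin.sum_univ_castSucc fun i => F (P.pt i)
  have h2 := Fin.sum_univ_succ fun i => F (P.pt i)
  rw [Finset.sum_sub_distrib, sub_eq_sub_iff_add_eq_add, add_comm, ← h2, h1, add_comm]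

theorem sum_length (P : Subdivision I) : ∑ i, (P.part i).length = I.length :=
  P.sum_sub fun t => (t : ℝ)

theorem sum_restr {ν : Measure ℝ} [IsProbabilityMeasure ν] [CompactlySupported ν]
    (P : Subdivision I) (k : ℕ) (f : H ν) :
    ∑ i, restr ν (P.part i) k f = restr ν I k f := by
  have h : ∀ J : Interval, restr ν J k f
      = restr ν (.upTo J.hi) k f - restr ν (.upTo J.lo) k f := fun J => by
    rw [restr_upTo_hi, add_sub_cancel_left]
  rw [h I, Finset.sum_congr rfl fun i _ => h (P.part i)]
  exact P.sum_sub fun t => restr ν (.upTo t) k f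

theorem length_le_mesh (P : Subdivision I) (i : Fin P.N) : (P.part i).length ≤ P.mesh :=
  le_ciSup (f := fun i => (P.part i).length) (Set.finite_range _).bddAbove i

theorem mesh_nonneg (P : Subdivision I) : 0 ≤ P.mesh := Real.iSup_nonneg fun _ => Interval.length_nonneg _

end Subdivision

theorem tendsto_mesh (I : Interval) : Tendsto Subdivision.mesh (meshFilter I) (𝓝 0) := tendsto_comap

/-- The subdivision into `n + 1` intervals of equal length. -/
def Subdivision.uniform (I : Interval) (h : I.lo < I.hi) (n : ℕ) : Subdivision I where
  N := n + 1
  pt i := I.lo + (I.hi - I.lo) * (i / (n + 1))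
  strictMono i j hij := by
    have : 0 < I.hi - I.lo := tsub_pos_of_lt h
    have h' : ((i : ℕ) : ℝ≥0) < (j : ℕ) := by exact_mod_cast hij
    dsimp only
    gcongr
  first := by simp
  last := by
    have : (n + 1 : ℝ≥0) ≠ 0 := by positivity
    simp [add_tsub_cancel_of_le I.le]

instance (I : Interval) : (meshFilter I).NeBot := by
  rw [meshFilter, comap_neBot_iff]
  intro s hs
  rcases I.le.eq_or_lt with h | h
  · refine ⟨⟨0, fun _ => I.lo, fun i j hij => absurd hij (by omega), rfl, h⟩, ?_⟩
    have : Subdivision.mesh (I := I) ⟨0, fun _ => I.lo, fun i j hij => absurd hij (by omega), rfl, h⟩ = 0 :=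
      Real.iSup_of_isEmpty _
    rw [this]; exact mem_of_mem_nhds hs
  · have h1 : ∀ n : ℕ, (Subdivision.uniform I h n).mesh = I.length * (1 / ((n : ℝ) + 1)) := by
      intro n
      have h2 : ∀ i, ((Subdivision.uniform I h n).part i).length
          = I.length * (1 / ((n : ℝ) + 1)) := by
        intro i
        rw [Interval.length, Subdivision.part_lo, Subdivision.part_hi]
        change ((I.lo + (I.hi - I.lo) * (((i : ℕ) + 1 : ℕ) / (n + 1)) : ℝ≥0) : ℝ)
          - ((I.lo + (I.hi - I.lo) * ((i : ℕ) / (n + 1)) : ℝ≥0) : ℝ)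
          = (I.hi - I.lo) * (1 / ((n : ℝ) + 1))
        push_cast [NNReal.coe_sub I.le]
        ring
      rw [Subdivision.mesh, funext h2]
      have : Nonempty (Fin (Subdivision.uniform I h n).N) := ⟨(0 : Fin (n + 1))⟩
      exact ciSup_const
    have h2 : Tendsto (fun n => (Subdivision.uniform I h n).mesh) atTop (𝓝 0) := by
      rw [funext h1]
      simpa using tendsto_one_div_add_atTop_nhds_zero_nat.const_mul I.length
    obtain ⟨n, hn⟩ := (h2.eventually hs).exists
    exact ⟨_, hn⟩

section Separating

variable {q : Set.Ioo (-1 : ℝ) 1} {ν : Measure ℝ} [IsProbabilityMeasure ν] [CompactlySupported ν]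

/-! ### The vector of a polynomial determines its operator -/

theorem coeFn_operator (f : Poly₀) (g : H ν) :
    operator ν f g =ᵐ[timeJump ν] fun p => (p.2 : ℂ) * vector ν f p * g p := by
  induction f using MonoidAlgebra.induction_linear with
  | zero =>
    filter_upwards [Lp.coeFn_zero ℂ 2 (timeJump ν)] with p hp
    rw [map_zero, map_zero, LinearMap.zero_apply, hp]
    simp
  | add f f' hf hf' =>
    simp only [map_add, LinearMap.add_apply]
    filter_upwards [hf, hf', Lp.coeFn_add (operator ν f g) (operator ν f' g),
      Lp.coeFn_add (vector ν f) (vector ν f')] with p h1 h2 h3 h4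
    rw [h3, h4, Pi.add_apply, Pi.add_apply, h1, h2]
    ring
  | single w r =>
    rw [vector_single, operator_single, wordOperator_eq]
    filter_upwards [Lp.coeFn_smul (r : ℂ) (mulOp ν (measurableSet_support w) w.length g),
      Lp.coeFn_smul (r : ℂ) (wordVector ν w), coeFn_wordVector (ν := ν) w,
      coeFn_mulOp (measurableSet_support w) w.length g] with p h1 h2 h3 h4
    have h5 : (p.2 : ℂ) * monomialFun (support w) (w.length - 1) p
        = monomialFun (support w) w.length p := by
      have h6 : w.length = w.length - 1 + 1 := (Nat.sub_add_cancel (length_pos w)).symm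
      conv_rhs => rw [h6]
      by_cases h : p.1 ∈ support w <;> simp [monomialFun, h, pow_succ']
    rw [LinearMap.smul_apply]
    refine h1.trans ?_
    rw [Pi.smul_apply, h4, h2, Pi.smul_apply, h3, ← h5, smul_eq_mul, smul_eq_mul]
    ring

theorem operator_eq_zero {f : Poly₀} (hf : vector ν f = 0) : operator ν f = 0 := by
  refine LinearMap.ext fun g => Lp.ext ?_
  filter_upwards [coeFn_operator f g, Lp.coeFn_zero ℂ 2 (timeJump ν)] with p h1 h2
  rw [h1, hf, LinearMap.zero_apply, h2]
  simp

theorem operator_eq_sum {ι : Type*} {s : Finset ι} {c : ι → ℝ} {g : ι → Poly₀} {f : Poly₀}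
    (h : vector ν f = ∑ j ∈ s, (c j : ℂ) • vector ν (g j)) :
    operator ν f = ∑ j ∈ s, (c j : ℂ) • operator ν (g j) := by
  have h1 : vector ν (f - ∑ j ∈ s, c j • g j) = 0 := by
    rw [map_sub, map_sum, h, sub_eq_zero]
    refine Finset.sum_congr rfl fun j _ => ?_
    rw [map_smul]
    exact (RCLike.real_smul_eq_coe_smul (K := ℂ) _ _).symm
  have h2 := operator_eq_zero h1
  rw [map_sub, map_sum, sub_eq_zero] at h2
  rw [h2]
  refine Finset.sum_congr rfl fun j _ => ?_
  rw [map_smul]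
  exact LinearMap.ext fun x => RCLike.real_smul_eq_coe_smul (K := ℂ) _ _

theorem fieldOperator_eq_sum {ι : Type*} {s : Finset ι} {c : ι → ℝ} {g : ι → Poly₀} {f : Poly₀}
    (h : vector ν f = ∑ j ∈ s, (c j : ℂ) • vector ν (g j)) :
    fieldOperator q ν f = ∑ j ∈ s, (c j : ℂ) • fieldOperator q ν (g j) := by
  classical
  rw [fieldOperator, h, operator_eq_sum h]
  clear h
  induction s using Finset.induction_on with
  | empty =>
    have := field_real_smul (q := q) 0 (0 : H ν) 0
    simpa using this
  | insert a s ha ih =>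
    rw [Finset.sum_insert ha, Finset.sum_insert ha, Finset.sum_insert ha, field_add, ih,
      field_real_smul]
    rfl

/-! ### The vectors of Wick products -/

variable (q ν) in
/-- The map `A ↦ A Ω`. -/
def vac : fullAlgebra q ν →ₗ[ℂ] Fock (H ν) q where
  toFun A := (A : Module.End ℂ (Fock (H ν) q)) (vacuum (H ν) q)
  map_add' _ _ := rfl
  map_smul' _ _ := rfl

theorem vac_mul (A B : fullAlgebra q ν) :
    vac q ν (A * B) = (A : Module.End ℂ (Fock (H ν) q)) (vac q ν B) := rfl

theorem vac_one : vac q ν 1 = vacuum (H ν) q := rfl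

theorem norm_vac (A : fullAlgebra q ν) : ‖vac q ν A‖ = ‖A‖ := rfl

theorem vac_XPoly_mul (f : Poly₀) (A : fullAlgebra q ν) :
    vac q ν (XPoly q ν f * A) = fieldOperator q ν f (vac q ν A) := rfl

theorem wick_nil : wick q ν [] = 1 := by rw [wick]

theorem wick_cons (f : Poly₀) (l : List Poly₀) : wick q ν (f :: l) = XPoly q ν f * wick q ν l
      - ∑ i : Fin l.length,
          (((q : ℝ) : ℂ) ^ (i : ℕ) * inner ℂ (vector ν f) (vector ν l[i])) • wick q ν (l.eraseIdx i)
      - ∑ i : Fin l.length, (((q : ℝ) : ℂ) ^ (i : ℕ)) • wick q ν (f * l[i] :: l.eraseIdx i) := by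
  rw [wick]

theorem length_eraseIdx_lt {α : Type*} (l : List α) (i : Fin l.length) :
    (l.eraseIdx i).length < l.length := by
  have := i.2
  rw [List.length_eraseIdx_of_lt this]; omega

theorem sum_fin_length_map {α β M : Type*} [AddCommMonoid M] (φ : α → β) (l : List α)
    (F : ℕ → β → M) :
    ∑ i : Fin (l.map φ).length, F i (l.map φ)[i] = ∑ i : Fin l.length, F i (φ l[i]) :=
  Fintype.sum_equiv (finCongr (List.length_map φ)) _ _ fun i => by simp

theorem vac_wick (l : List Poly₀) : vac q ν (wick q ν l) = listTensor q (l.map (vector ν)) := by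
  induction hn : l.length using Nat.strong_induction_on generalizing l with
  | _ n ih =>
  subst hn
  cases l with
  | nil => rw [wick_nil, List.map_nil, listTensor_nil, vac_one]
  | cons f l =>
    have ihl := ih _ (Nat.lt_succ_self l.length) l rfl
    have ih1 : ∀ i : Fin l.length, vac q ν (wick q ν (l.eraseIdx i))
        = listTensor q ((l.map (vector ν)).eraseIdx i) := fun i => by
      rw [ih _ ((length_eraseIdx_lt l i).trans (Nat.lt_succ_self _)) _ rfl, List.eraseIdx_map]
    have ih2 : ∀ i : Fin l.length, vac q ν (wick q ν (f * l[i] :: l.eraseIdx i))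
        = listTensor q (operator ν f (vector ν l[i]) :: (l.map (vector ν)).eraseIdx i) := fun i => by
      rw [ih _ (Nat.succ_lt_succ (length_eraseIdx_lt l i)) _ rfl, List.map_cons,
        List.eraseIdx_map, operator_vector]
    rw [wick_cons, map_sub, map_sub, vac_XPoly_mul, ihl, map_sum, map_sum]
    simp only [map_smul, ih1, ih2]
    rw [fieldOperator, field, LinearMap.add_apply, LinearMap.add_apply, annihilation_listTensor,
      gauge_listTensor, creation_listTensor,
      sum_fin_length_map (vector ν) l fun i x =>
        (((q : ℝ) : ℂ) ^ i * inner ℂ (vector ν f) x) • listTensor q ((l.map (vector ν)).eraseIdx i),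
      sum_fin_length_map (vector ν) l fun i x =>
        (((q : ℝ) : ℂ) ^ i) • listTensor q (operator ν f x :: (l.map (vector ν)).eraseIdx i),
      List.map_cons]
    abel

/-- A Wick product is linear in the vector of its first factor. -/
theorem wick_cons_eq_sum {ι : Type*} {s : Finset ι} {c : ι → ℝ} {g : ι → Poly₀} (l : List Poly₀)
    {f : Poly₀} (h : vector ν f = ∑ j ∈ s, (c j : ℂ) • vector ν (g j)) :
    wick q ν (f :: l) = ∑ j ∈ s, (c j : ℂ) • wick q ν (g j :: l) := by
  induction hn : l.length using Nat.strong_induction_on generalizing l f g with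
  | _ n ih =>
  subst hn
  have hX : XPoly q ν f = ∑ j ∈ s, (c j : ℂ) • XPoly q ν (g j) := by
    apply Subtype.ext
    rw [AddSubmonoidClass.coe_finsetSum]
    exact fieldOperator_eq_sum h
  have h1 : ∀ i : Fin l.length, wick q ν (f * l[i] :: l.eraseIdx i)
      = ∑ j ∈ s, (c j : ℂ) • wick q ν (g j * l[i] :: l.eraseIdx i) := fun i => by
    refine ih _ (length_eraseIdx_lt l i) (g := fun j => g j * l[i]) _ ?_ rfl
    simp only [← operator_vector, operator_eq_sum h, LinearMap.sum_apply, LinearMap.smul_apply]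
  have h2 : ∀ i : Fin l.length, inner ℂ (vector ν f) (vector ν l[i])
      = ∑ j ∈ s, (c j : ℂ) * inner ℂ (vector ν (g j)) (vector ν l[i]) := fun i => by
    rw [h, sum_inner]
    simp only [inner_smul_left, Complex.conj_ofReal]
  rw [wick_cons, Finset.sum_congr rfl fun j _ => congrArg _ (wick_cons (g j) l)]
  simp only [h1, h2, hX, Finset.sum_mul, Finset.mul_sum, Finset.sum_smul,
    Finset.smul_sum, smul_sub, Finset.sum_sub_distrib, smul_mul_assoc, smul_smul]
  congr 1
  · congr 1
    rw [Finset.sum_comm]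
    simp only [mul_left_comm]
  · rw [Finset.sum_comm]
    simp only [mul_comm]

/-! ### The vacuum is separating -/

theorem eq_zero_of_add_I_smul {x y : H ν} (hx : x ∈ LinearMap.range (vector ν))
    (hy : y ∈ LinearMap.range (vector ν)) (h : x + Complex.I • y = 0) : x = 0 ∧ y = 0 := by
  obtain ⟨f, rfl⟩ := hx
  obtain ⟨g, rfl⟩ := hy
  have h0 : (inner ℂ (vector ν f) (vector ν g)).im = 0 :=
    Complex.conj_eq_iff_im.mp (conj_inner_vector f g)
  have h1 : ‖vector ν f + Complex.I • vector ν g‖ ^ 2 = ‖vector ν f‖ ^ 2 + ‖vector ν g‖ ^ 2 := by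
    rw [norm_add_sq (𝕜 := ℂ), inner_smul_right, norm_smul, Complex.norm_I, one_mul]
    simp [h0]
  rw [h, norm_zero] at h1
  have hf := sq_nonneg ‖vector ν f‖
  have hg := sq_nonneg ‖vector ν g‖
  constructor
  · exact norm_eq_zero.mp (pow_eq_zero_iff two_ne_zero |>.mp (by linarith))
  · exact norm_eq_zero.mp (pow_eq_zero_iff two_ne_zero |>.mp (by linarith))

theorem linearIndependent_complex {ι : Type*} {e : ι → LinearMap.range (vector ν)}
    (he : LinearIndependent ℝ e) : LinearIndependent ℂ fun i => (e i : H ν) := by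
  rw [linearIndependent_iff']
  intro s c hc i hi
  have h1 : ∀ d : ι → ℝ, ((∑ j ∈ s, d j • e j : LinearMap.range (vector ν)) : H ν)
      = ∑ j ∈ s, ((d j : ℝ) : ℂ) • (e j : H ν) := by
    intro d
    rw [AddSubmonoidClass.coe_finsetSum]
    exact Finset.sum_congr rfl fun j _ => RCLike.real_smul_eq_coe_smul (K := ℂ) _ _
  have h2 := eq_zero_of_add_I_smul (x := ∑ j ∈ s, (((c j).re : ℝ) : ℂ) • (e j : H ν))
    (y := ∑ j ∈ s, (((c j).im : ℝ) : ℂ) • (e j : H ν))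
    (by rw [← h1]; exact SetLike.coe_mem _) (by rw [← h1]; exact SetLike.coe_mem _) (by
      rw [← hc, Finset.smul_sum, ← Finset.sum_add_distrib]
      refine Finset.sum_congr rfl fun j _ => ?_
      rw [smul_smul, ← add_smul, mul_comm, Complex.re_add_im])
  rw [linearIndependent_iff'] at he
  rw [← h1, ← h1] at h2
  exact Complex.ext (he s _ (Subtype.ext h2.1) i hi) (he s _ (Subtype.ext h2.2) i hi)

variable (ν) in
/-- Polynomials whose vectors form a real basis of the space of all vectors of polynomials. -/
def basisPoly (b : Module.Basis.ofVectorSpaceIndex ℝ (LinearMap.range (vector ν))) : Poly₀ :=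
  (Module.Basis.ofVectorSpace ℝ (LinearMap.range (vector ν)) b).2.choose

theorem vector_basisPoly (b : Module.Basis.ofVectorSpaceIndex ℝ (LinearMap.range (vector ν))) :
    vector ν (basisPoly ν b)
      = (Module.Basis.ofVectorSpace ℝ (LinearMap.range (vector ν)) b : H ν) :=
  (Module.Basis.ofVectorSpace ℝ (LinearMap.range (vector ν)) b).2.choose_spec

theorem exists_vector_eq_sum (f : Poly₀) :
    ∃ (s : Finset _) (c : _ → ℝ), vector ν f = ∑ b ∈ s, (c b : ℂ) • vector ν (basisPoly ν b) := by
  let B := Module.Basis.ofVectorSpace ℝ (LinearMap.range (vector ν))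
  let x : LinearMap.range (vector ν) := ⟨vector ν f, f, rfl⟩
  refine ⟨(B.repr x).support, B.repr x, ?_⟩
  have h := congrArg (Subtype.val) (B.linearCombination_repr x)
  rw [Finsupp.linearCombination_apply, Finsupp.sum, AddSubmonoidClass.coe_finsetSum] at h
  rw [← show (x : H ν) = vector ν f from rfl, ← h]
  refine Finset.sum_congr rfl fun b _ => ?_
  rw [vector_basisPoly]
  exact RCLike.real_smul_eq_coe_smul (K := ℂ) _ _

variable (q ν) in
/-- The span of the Wick products of the basis polynomials. -/
def wickSpan : Submodule ℂ (fullAlgebra q ν) :=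
  Submodule.span ℂ (Set.range fun l : List _ => wick q ν (l.map (basisPoly ν)))

theorem wick_cons_mem_wickSpan (f : Poly₀) (l : List _) :
    wick q ν (f :: l.map (basisPoly ν)) ∈ wickSpan q ν := by
  obtain ⟨s, c, h⟩ := exists_vector_eq_sum (ν := ν) f
  rw [wick_cons_eq_sum _ h]
  exact Submodule.sum_mem _ fun b _ => Submodule.smul_mem _ _ (Submodule.subset_span ⟨b :: l, rfl⟩)

theorem XPoly_mul_mem_wickSpan (f : Poly₀) {A : fullAlgebra q ν} (hA : A ∈ wickSpan q ν) :
    XPoly q ν f * A ∈ wickSpan q ν := by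
  induction hA using Submodule.span_induction with
  | mem A hA =>
    obtain ⟨l, rfl⟩ := hA
    dsimp only
    have h := wick_cons (q := q) (ν := ν) f (l.map (basisPoly ν))
    rw [sub_sub, eq_sub_iff_add_eq] at h
    rw [← h]
    refine add_mem (wick_cons_mem_wickSpan f l) (add_mem ?_ ?_)
    · refine Submodule.sum_mem _ fun i _ => Submodule.smul_mem _ _ ?_
      rw [List.eraseIdx_map]
      exact Submodule.subset_span ⟨_, rfl⟩
    · refine Submodule.sum_mem _ fun i _ => Submodule.smul_mem _ _ ?_
      rw [List.eraseIdx_map]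
      exact wick_cons_mem_wickSpan _ _
  | zero => rw [mul_zero]; exact zero_mem _
  | add A B _ _ hA hB => rw [mul_add]; exact add_mem hA hB
  | smul c A _ hA => rw [mul_smul_comm]; exact Submodule.smul_mem _ _ hA

theorem wickSpan_eq_top : wickSpan q ν = ⊤ := by
  have h1 : ∀ (T : Module.End ℂ (Fock (H ν) q)) (hT : T ∈ fullAlgebra q ν), ∀ B ∈ wickSpan q ν,
      (⟨T, hT⟩ : fullAlgebra q ν) * B ∈ wickSpan q ν := by
    intro T hT
    induction hT using Algebra.adjoin_induction with
    | mem T hT =>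
      obtain ⟨f, rfl⟩ := hT
      exact fun B hB => XPoly_mul_mem_wickSpan f hB
    | algebraMap c =>
      intro B hB
      have : (⟨algebraMap ℂ _ c, algebraMap_mem _ c⟩ : fullAlgebra q ν) * B = c • B :=
        (Algebra.smul_def c B).symm
      rw [this]
      exact Submodule.smul_mem _ _ hB
    | add S T hS hT ihS ihT =>
      intro B hB
      have : (⟨S + T, add_mem hS hT⟩ : fullAlgebra q ν) * B = ⟨S, hS⟩ * B + ⟨T, hT⟩ * B :=
        add_mul (⟨S, hS⟩ : fullAlgebra q ν) ⟨T, hT⟩ B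
      rw [this]
      exact add_mem (ihS B hB) (ihT B hB)
    | mul S T hS hT ihS ihT =>
      intro B hB
      have : (⟨S * T, mul_mem hS hT⟩ : fullAlgebra q ν) * B = ⟨S, hS⟩ * (⟨T, hT⟩ * B) :=
        mul_assoc (⟨S, hS⟩ : fullAlgebra q ν) ⟨T, hT⟩ B
      rw [this]
      exact ihS _ (ihT B hB)
  refine eq_top_iff.mpr fun A _ => ?_
  have h2 := h1 A A.2 1 (Submodule.subset_span ⟨[], wick_nil⟩)
  rwa [mul_one] at h2

theorem span_range_wick : Submodule.span ℂ (Set.range (wick q ν)) = ⊤ := by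
  refine eq_top_iff.mpr (wickSpan_eq_top.ge.trans (Submodule.span_mono ?_))
  rintro _ ⟨l, rfl⟩
  exact ⟨_, rfl⟩

variable (q ν) in
/-- The vacuum vector is separating for the algebra. -/
theorem vac_injective : Function.Injective (vac q ν) := by
  rw [injective_iff_map_eq_zero]
  intro A hA
  have h1 : A ∈ wickSpan q ν := wickSpan_eq_top.ge trivial
  rw [wickSpan, Finsupp.mem_span_range_iff_exists_finsupp] at h1
  obtain ⟨c, rfl⟩ := h1
  have h2 := linearIndependent_listTensor (q := q) (linearIndependent_complex
    (Module.Basis.ofVectorSpace ℝ (LinearMap.range (vector ν))).linearIndependent)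
  rw [linearIndependent_iff] at h2
  rw [h2 c ?_, Finsupp.sum_zero_index]
  rw [map_finsuppSum] at hA
  rw [← hA, Finsupp.linearCombination_apply]
  refine Finsupp.sum_congr fun l _ => ?_
  rw [map_smul, vac_wick, List.map_map]
  congr 3
  exact funext fun b => (vector_basisPoly b).symm

/-! ### The second quantization -/

theorem IsSecondQuantization.vac_apply {Γ : fullAlgebra q ν →ₗ[ℂ] fullAlgebra q ν}
    (hΓ : IsSecondQuantization q ν Γ) (A : fullAlgebra q ν) :
    vac q ν (Γ A) = qPowNumber (H ν) q (vac q ν A) := by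
  suffices h : vac q ν ∘ₗ Γ = qPowNumber (H ν) q ∘ₗ vac q ν from LinearMap.congr_fun h A
  refine LinearMap.ext_on_range span_range_wick fun l => ?_
  rw [LinearMap.comp_apply, LinearMap.comp_apply, hΓ, map_smul, vac_wick, qPowNumber_listTensor,
    List.length_map]

variable (q ν) in
theorem existsUnique_isSecondQuantization :
    ∃! Γ : fullAlgebra q ν →ₗ[ℂ] fullAlgebra q ν, IsSecondQuantization q ν Γ := by
  obtain ⟨ρ, hρ⟩ := LinearMap.exists_leftInverse_of_injective (vac q ν)
    (LinearMap.ker_eq_bot.mpr (vac_injective q ν))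
  refine ⟨ρ ∘ₗ qPowNumber (H ν) q ∘ₗ vac q ν, fun l => ?_, fun Γ hΓ => ?_⟩
  · rw [LinearMap.comp_apply, LinearMap.comp_apply, vac_wick, qPowNumber_listTensor,
      List.length_map, ← vac_wick, map_smul]
    exact congrArg _ (LinearMap.congr_fun hρ _)
  · refine LinearMap.ext fun A => vac_injective q ν ?_
    rw [hΓ.vac_apply, LinearMap.comp_apply, LinearMap.comp_apply, ← hΓ.vac_apply]
    exact (congrArg _ (LinearMap.congr_fun hρ _)).symm

end Separating

end QLevy

namespace QFock

variable {E : Type*} [NormedAddCommGroup E] [InnerProductSpace ℂ E] {q : Set.Ioo (-1 : ℝ) 1}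

theorem span_tensor : Submodule.span ℂ {v : Fock E q | ∃ (n : ℕ) (η : Fin n → E), v = tensor q η}
    = ⊤ := by
  rw [← Submodule.ker_mkQ (Submodule.span ℂ {v : Fock E q | ∃ (n : ℕ) (η : Fin n → E),
    v = tensor q η}), LinearMap.ker_eq_top]
  refine fock_hom_ext fun n η => ?_
  rw [LinearMap.zero_apply, Submodule.mkQ_apply, Submodule.Quotient.mk_eq_zero]
  exact Submodule.subset_span ⟨n, η, rfl⟩

/-- The action of a field operator on a tensor, singling out its `k`-th factor. -/
theorem field_tensor_update (ζ : E) (S : E →ₗ[ℂ] E) {n : ℕ} (η : Fin (n + 1) → E)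
    (k : Fin (n + 1)) (x : E) :
    field ζ S (tensor q (Function.update η k x))
      = tensor q (Function.update (Fin.cons ζ η : Fin (n + 2) → E) k.succ x)
        + ((q : ℝ) : ℂ) ^ (k : ℕ) • (inner ℂ ζ x • tensor q (k.removeNth η)
          + creation (S x) (tensor q (k.removeNth η)))
        + ∑ m : Fin n, ((q : ℝ) : ℂ) ^ (k.succAbove m : ℕ) •
          (inner ℂ ζ (η (k.succAbove m)) •
              tensor q (Function.update ((k.succAbove m).removeNth η) (m.predAbove k) x)
            + tensor q (Function.update
              (Fin.cons (S (η (k.succAbove m))) ((k.succAbove m).removeNth η) : Fin (n + 1) → E)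
              (m.predAbove k).succ x)) := by
  have h : ∀ m : Fin n, (k.succAbove m).removeNth (Function.update η k x)
      = Function.update ((k.succAbove m).removeNth η) (m.predAbove k) x := by
    have h' : ∀ (p : Fin (n + 1)) (i : Fin n) (k : Fin (n + 1)), p.succAbove i = k →
        p.removeNth (Function.update η k x) = Function.update (p.removeNth η) i x := by
      rintro p i _ rfl
      exact Fin.removeNth_update_succAbove p i x η
    exact fun m => h' _ _ _ (Fin.succAbove_succAbove_predAbove k m)
  rw [field, LinearMap.add_apply, LinearMap.add_apply, annihilation_tensor, gauge_tensor,
    creation_tensor, Fin.sum_univ_succAbove _ k, Fin.sum_univ_succAbove _ k]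
  simp only [h, Fin.removeNth_update, Function.update_self,
    Function.update_of_ne (Fin.succAbove_ne k _), Fin.cons_update, creation_tensor, smul_add,
    Finset.sum_add_distrib, smul_smul]
  abel

theorem prod_norm_update {n : ℕ} (η : Fin n → E) (k : Fin n) (x : E) :
    ∏ j, ‖Function.update η k x j‖ ^ 2 = ‖x‖ ^ 2 * ∏ j ∈ Finset.univ.erase k, ‖η j‖ ^ 2 := by
  rw [← Finset.mul_prod_erase _ _ (Finset.mem_univ k), Function.update_self]
  congr 1
  refine Finset.prod_congr rfl fun j hj => ?_
  rw [Function.update_of_ne (Finset.ne_of_mem_erase hj)]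

theorem inner_tensor_one (x y : E) :
    inner ℂ (tensor q fun _ : Fin 1 => x) (tensor q fun _ : Fin 1 => y) = inner ℂ x y := by
  rw [inner_tensor_tensor, Fintype.sum_unique, Fin.prod_univ_one]
  have : inversions (default : Equiv.Perm (Fin 1)) = 0 := by decide
  rw [this, pow_zero, one_mul]

end QFock

namespace QLevy

open QFock

section Limits

variable {q : Set.Ioo (-1 : ℝ) 1} {ν : Measure ℝ} [IsProbabilityMeasure ν] [CompactlySupported ν]

/-! ### Limits of sums over subdivisions -/

/-- The sums of `Φ` over the intervals of a subdivision of `I` tend to `L`. -/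
def HasMeshLimit {F : Type*} [AddCommMonoid F] [TopologicalSpace F] (I : Interval)
    (Φ : Interval → F) (L : F) : Prop :=
  Tendsto (fun P : Subdivision I => ∑ i, Φ (P.part i)) (meshFilter I) (𝓝 L)

namespace HasMeshLimit

variable {F : Type*} [NormedAddCommGroup F] [NormedSpace ℂ F] {I : Interval} {Φ Ψ : Interval → F}
  {L M : F}

theorem add (h : HasMeshLimit I Φ L) (h' : HasMeshLimit I Ψ M) :
    HasMeshLimit I (fun J => Φ J + Ψ J) (L + M) := by
  simpa only [HasMeshLimit, Finset.sum_add_distrib] using Tendsto.add h h'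

theorem const_smul (c : ℂ) (h : HasMeshLimit I Φ L) :
    HasMeshLimit I (fun J => c • Φ J) (c • L) := by
  simpa only [HasMeshLimit, Finset.smul_sum] using Tendsto.const_smul h c

theorem sum {ι : Type*} {s : Finset ι} {Φ : ι → Interval → F} {L : ι → F}
    (h : ∀ j ∈ s, HasMeshLimit I (Φ j) (L j)) :
    HasMeshLimit I (fun J => ∑ j ∈ s, Φ j J) (∑ j ∈ s, L j) := by
  have := tendsto_finsetSum s h
  simp only [Finset.sum_comm (s := s)] at this
  exact this

theorem of_sum_eq (h : ∀ P : Subdivision I, ∑ i, Φ (P.part i) = L) : HasMeshLimit I Φ L := by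
  simpa only [HasMeshLimit, h] using tendsto_const_nhds

theorem congr (h : HasMeshLimit I Φ L) (h' : ∀ J, Φ J = Ψ J) : HasMeshLimit I Ψ L := by
  rwa [← funext h']

end HasMeshLimit

/-- Sums of tensors orthogonal in a slot and of square norms `o(|J|)` are negligible. -/
theorem hasMeshLimit_zero {I : Interval} {n : ℕ} (c : Interval → ℂ)
    (ζ : Interval → Fin n → H ν) (m : Interval → ℝ) (M : ℝ)
    (horth : ∀ J J' : Interval, Disjoint J.toSet J'.toSet → ∃ k, inner ℂ (ζ J k) (ζ J' k) = 0)
    (hbound : ∀ J, ‖c J‖ ^ 2 * ∏ k, ‖ζ J k‖ ^ 2 ≤ J.length * m J) (hm0 : ∀ J, 0 ≤ m J)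
    (hm : ∀ P : Subdivision I, ∑ i, m (P.part i) ≤ M) :
    HasMeshLimit I (fun J => c J • tensor q (ζ J)) 0 := by
  rw [HasMeshLimit, tendsto_zero_iff_norm_tendsto_zero]
  have h1 : Tendsto (fun P : Subdivision I => √(n.factorial * M * P.mesh)) (meshFilter I) (𝓝 0) := by
    simpa using ((tendsto_mesh I).const_mul (n.factorial * M)).sqrt
  refine squeeze_zero (fun _ => norm_nonneg _) (fun P => Real.le_sqrt_of_sq_le ?_) h1
  refine (norm_sum_tensor_sq_le Finset.univ (fun i => c (P.part i)) (fun i => ζ (P.part i))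
    fun i _ j _ hij => horth _ _ (P.disjoint_part hij)).trans ?_
  rw [mul_assoc]
  refine mul_le_mul_of_nonneg_left ?_ (Nat.cast_nonneg _)
  calc _ ≤ ∑ i, P.mesh * m (P.part i) := Finset.sum_le_sum fun i _ => (hbound _).trans
        (mul_le_mul_of_nonneg_right (P.length_le_mesh i) (hm0 _))
    _ = (∑ i, m (P.part i)) * P.mesh := by rw [← Finset.mul_sum, mul_comm]
    _ ≤ _ := mul_le_mul_of_nonneg_right (hm P) P.mesh_nonneg

theorem Subdivision.sum_norm_restr_sq {I : Interval} (P : Subdivision I) (k : ℕ) (f : H ν) :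
    ∑ i, ‖restr ν (P.part i) k f‖ ^ 2 = ‖restr ν I k f‖ ^ 2 := by
  have h : ((∑ i, ‖restr ν (P.part i) k f‖ ^ 2 : ℝ) : ℂ) = ((‖restr ν I k f‖ ^ 2 : ℝ) : ℂ) := by
    rw [Complex.ofReal_pow]
    refine Eq.trans ?_ (inner_self_eq_norm_sq_to_K (𝕜 := ℂ) (restr ν I k f))
    rw [← P.sum_restr, sum_inner, Complex.ofReal_sum]
    refine Finset.sum_congr rfl fun i _ => ?_
    rw [inner_sum, Finset.sum_eq_single_of_mem i (Finset.mem_univ i) fun j _ hj =>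
      inner_restr_restr_of_disjoint (P.disjoint_part hj.symm) _ _ _ _, inner_self_eq_norm_sq_to_K,
      Complex.ofReal_pow]
    rfl
  exact_mod_cast h

theorem restr_commutes {T : H ν →L[ℂ] H ν} (hT : T ∈ multiplierCommutant ν) (J : Interval) (k : ℕ)
    (f : H ν) : T (restr ν J k f) = restr ν J k (T f) := hT _ _ _ _

theorem inner_apply_intervalVector {T : H ν →L[ℂ] H ν} (hT : T ∈ multiplierCommutant ν)
    {J J' : Interval} (h : Disjoint J.toSet J'.toSet) :
    inner ℂ (T (intervalVector ν J 0)) (T (intervalVector ν J' 0)) = 0 := by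
  rw [← restr_intervalVector (Set.Subset.refl J.toSet) 0 0,
    ← restr_intervalVector (Set.Subset.refl J'.toSet) 0 0, restr_commutes hT, restr_commutes hT,
    inner_restr_restr_of_disjoint h]

theorem norm_apply_intervalVector_sq_le (T : H ν →L[ℂ] H ν) (J : Interval) :
    ‖T (intervalVector ν J 0)‖ ^ 2 ≤ ‖T‖ ^ 2 * J.length := by
  rw [← norm_intervalVector_sq (ν := ν) J, ← mul_pow]
  exact pow_le_pow_left₀ (norm_nonneg _) (T.le_opNorm _) 2

theorem hasMeshLimit_smul_tensor_update (I : Interval) {n : ℕ} (η : Fin n → H ν) (k : Fin n)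
    {T : H ν →L[ℂ] H ν} (hT : T ∈ multiplierCommutant ν) {c : Interval → ℂ} {C : ℝ} (hC : 0 ≤ C)
    (hc : ∀ J, ‖c J‖ ^ 2 ≤ C * J.length) :
    HasMeshLimit I (fun J => c J • tensor q (Function.update η k (T (intervalVector ν J 0)))) 0 := by
  set K := ∏ j ∈ Finset.univ.erase k, ‖η j‖ ^ 2 with hK
  have hK0 : 0 ≤ K := Finset.prod_nonneg fun _ _ => sq_nonneg _
  refine hasMeshLimit_zero c _ (fun J => C * ‖T‖ ^ 2 * K * J.length) (C * ‖T‖ ^ 2 * K * I.length)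
    (fun J J' h => ⟨k, by simpa using inner_apply_intervalVector hT h⟩) (fun J => ?_)
    (fun J => mul_nonneg (by positivity) (Interval.length_nonneg J))
    (fun P => by rw [← Finset.mul_sum, P.sum_length])
  rw [prod_norm_update, ← hK]
  have hJ := Interval.length_nonneg J
  calc ‖c J‖ ^ 2 * (‖T (intervalVector ν J 0)‖ ^ 2 * K)
      ≤ (C * J.length) * ((‖T‖ ^ 2 * J.length) * K) := by
        gcongr
        · exact hc J
        · exact norm_apply_intervalVector_sq_le T J
    _ = _ := by ring

theorem hasMeshLimit_tensor_cons_vector (I : Interval) {n : ℕ} (η : Fin n → H ν) (k : Fin n)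
    {T : H ν →L[ℂ] H ν} (hT : T ∈ multiplierCommutant ν) :
    HasMeshLimit I (fun J => tensor q (Function.update
      (Fin.cons (intervalVector ν J 0) η : Fin (n + 1) → H ν) k.succ (T (intervalVector ν J 0)))) 0 := by
  set K := ∏ j ∈ Finset.univ.erase k, ‖η j‖ ^ 2 with hK
  have hK0 : 0 ≤ K := Finset.prod_nonneg fun _ _ => sq_nonneg _
  refine (hasMeshLimit_zero (fun _ => 1) (fun J => Function.update
    (Fin.cons (intervalVector ν J 0) η : Fin (n + 1) → H ν) k.succ (T (intervalVector ν J 0)))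
    (fun J => ‖T‖ ^ 2 * K * J.length) (‖T‖ ^ 2 * K * I.length)
    (fun J J' h => ⟨k.succ, by simpa using inner_apply_intervalVector hT h⟩) (fun J => ?_)
    (fun J => mul_nonneg (by positivity) (Interval.length_nonneg J))
    (fun P => by rw [← Finset.mul_sum, P.sum_length])).congr fun J => one_smul _ _
  rw [← Fin.cons_update, Fin.prod_univ_succ]
  simp only [Fin.cons_zero, Fin.cons_succ, norm_intervalVector_sq, norm_one, one_pow, one_mul]
  rw [prod_norm_update, ← hK]
  refine mul_le_mul_of_nonneg_left ?_ (Interval.length_nonneg J)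
  calc _ ≤ (‖T‖ ^ 2 * J.length) * K := by
        gcongr
        exact norm_apply_intervalVector_sq_le T J
    _ = _ := by ring

theorem hasMeshLimit_tensor_cons_restr (I : Interval) {n : ℕ} (η : Fin n → H ν) (k : Fin n)
    {T : H ν →L[ℂ] H ν} (hT : T ∈ multiplierCommutant ν) (f : H ν) :
    HasMeshLimit I (fun J => tensor q (Function.update
      (Fin.cons (restr ν J 1 f) η : Fin (n + 1) → H ν) k.succ (T (intervalVector ν J 0)))) 0 := by
  set K := ∏ j ∈ Finset.univ.erase k, ‖η j‖ ^ 2 with hK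
  have hK0 : 0 ≤ K := Finset.prod_nonneg fun _ _ => sq_nonneg _
  refine (hasMeshLimit_zero (fun _ => 1) (fun J => Function.update
    (Fin.cons (restr ν J 1 f) η : Fin (n + 1) → H ν) k.succ (T (intervalVector ν J 0)))
    (fun J => ‖T‖ ^ 2 * K * ‖restr ν J 1 f‖ ^ 2) (‖T‖ ^ 2 * K * ‖restr ν I 1 f‖ ^ 2)
    (fun J J' h => ⟨k.succ, by simpa using inner_apply_intervalVector hT h⟩) (fun J => ?_)
    (fun J => by positivity)
    (fun P => by rw [← Finset.mul_sum, P.sum_norm_restr_sq])).congr fun J => one_smul _ _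
  rw [← Fin.cons_update, Fin.prod_univ_succ]
  simp only [Fin.cons_zero, Fin.cons_succ, norm_one, one_pow, one_mul]
  rw [prod_norm_update, ← hK]
  calc _ ≤ ‖restr ν J 1 f‖ ^ 2 * ((‖T‖ ^ 2 * J.length) * K) := by
        gcongr
        exact norm_apply_intervalVector_sq_le T J
    _ = _ := by ring

theorem hasMeshLimit_smul_creation_restr (I : Interval) {n : ℕ} (η : Fin n → H ν) (f : H ν)
    {c : Interval → ℂ} {C : ℝ} (hC : 0 ≤ C) (hc : ∀ J, ‖c J‖ ^ 2 ≤ C * J.length) :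
    HasMeshLimit I (fun J => c J • creation (restr ν J 1 f) (tensor q η)) 0 := by
  set K := ∏ j, ‖η j‖ ^ 2 with hK
  have hK0 : 0 ≤ K := Finset.prod_nonneg fun _ _ => sq_nonneg _
  simp only [creation_tensor]
  refine hasMeshLimit_zero c _ (fun J => C * K * ‖restr ν J 1 f‖ ^ 2)
    (C * K * ‖restr ν I 1 f‖ ^ 2)
    (fun J J' h => ⟨0, by simpa using inner_restr_restr_of_disjoint h 1 1 f f⟩) (fun J => ?_)
    (fun J => by positivity) (fun P => by rw [← Finset.mul_sum, P.sum_norm_restr_sq])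
  rw [Fin.prod_univ_succ]
  simp only [Fin.cons_zero, Fin.cons_succ, ← hK]
  calc _ ≤ (C * J.length) * (‖restr ν J 1 f‖ ^ 2 * K) := by
        gcongr
        exact hc J
    _ = _ := by ring

theorem id_mem_multiplierCommutant : ContinuousLinearMap.id ℂ (H ν) ∈ multiplierCommutant ν :=
  fun _ _ _ _ => rfl

theorem norm_functional_sq_le (c : H ν →L[ℂ] ℂ) (J : Interval) :
    ‖c (intervalVector ν J 0)‖ ^ 2 ≤ ‖c‖ ^ 2 * J.length := by
  rw [← norm_intervalVector_sq (ν := ν) J, ← mul_pow]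
  exact pow_le_pow_left₀ (norm_nonneg _) (c.le_opNorm _) 2

theorem hasMeshLimit_smul_inner (I : Interval) (c : H ν →L[ℂ] ℂ) (f : H ν) :
    HasMeshLimit I (fun J => c (intervalVector ν J 0) * inner ℂ (intervalVector ν J 0) f) 0 := by
  let q : Set.Ioo (-1 : ℝ) 1 := ⟨0, by norm_num⟩
  have h1 := hasMeshLimit_smul_tensor_update (q := q) I (fun _ : Fin 1 => (0 : H ν)) 0
    id_mem_multiplierCommutant (c := fun J => (starRingEnd ℂ) (c (intervalVector ν J 0)))
    (sq_nonneg ‖c‖) (fun J => by rw [RCLike.norm_conj]; exact norm_functional_sq_le c J)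
  have h2 : Tendsto (fun v : Fock (H ν) q => inner ℂ v (tensor q fun _ : Fin 1 => f)) (𝓝 0) (𝓝 0) := by
    have : Continuous fun v : Fock (H ν) q => inner ℂ v (tensor q fun _ : Fin 1 => f) := by fun_prop
    simpa using this.tendsto 0
  refine (h2.comp h1).congr fun P => ?_
  rw [Function.comp_apply, sum_inner]
  refine Finset.sum_congr rfl fun i _ => ?_
  have h3 : ∀ x : H ν, Function.update (fun _ : Fin 1 => (0 : H ν)) 0 x = fun _ => x := by
    intro x; funext j; rw [Fin.fin_one_eq_zero j, Function.update_self]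
  rw [inner_smul_left, h3, inner_tensor_one, RCLike.conj_conj]
  rfl

/-! ### The sums of the sandwiched products -/

theorem X_apply (J : Interval) (v : Fock (H ν) q) :
    (X q ν J : Module.End ℂ (Fock (H ν) q)) v
      = field (intervalVector ν J 0) (restr ν J 1).toLinearMap v := by
  change fieldOperator q ν _ v = _
  rw [fieldOperator, operator_powWord J le_rfl, vector_powWord J 0]

theorem hasMeshLimit_X_tensor_update (I : Interval) {n : ℕ} (η : Fin (n + 1) → H ν)
    (k : Fin (n + 1)) {T : H ν →L[ℂ] H ν} (hT : T ∈ multiplierCommutant ν) :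
    HasMeshLimit I (fun J => (X q ν J : Module.End ℂ (Fock (H ν) q))
        (tensor q (Function.update η k (T (intervalVector ν J 0)))))
      (((q : ℝ) : ℂ) ^ (k : ℕ) •
        (inner ℂ (intervalVector ν I 0) (T (intervalVector ν I 0)) • tensor q (k.removeNth η)
          + creation (T (intervalVector ν I 1)) (tensor q (k.removeNth η)))) := by
  have hpart : ∀ P : Subdivision I, ∀ i,
      intervalVector ν (P.part i) 0 = restr ν (P.part i) 0 (intervalVector ν I 0) :=
    fun P i => (restr_intervalVector (P.part_subset i) 0 0).symm
  have h1 : HasMeshLimit I (fun J => inner ℂ (intervalVector ν J 0) (T (intervalVector ν J 0)) •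
      tensor q (k.removeNth η))
      (inner ℂ (intervalVector ν I 0) (T (intervalVector ν I 0)) • tensor q (k.removeNth η)) := by
    refine HasMeshLimit.of_sum_eq fun P => ?_
    rw [← Finset.sum_smul]
    congr 1
    calc _ = ∑ i, inner ℂ (intervalVector ν I 0)
          (restr ν (P.part i) 0 (T (intervalVector ν I 0))) := by
          refine Finset.sum_congr rfl fun i _ => ?_
          rw [hpart, restr_commutes hT, restr, inner_mulOp, ← restr, restr_restr_self]
      _ = _ := by
          rw [← inner_sum, P.sum_restr, ← restr_commutes hT,
            restr_intervalVector (Set.Subset.refl _)]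
  have h2 : HasMeshLimit I (fun J => creation (restr ν J 1 (T (intervalVector ν J 0)))
      (tensor q (k.removeNth η))) (creation (T (intervalVector ν I 1)) (tensor q (k.removeNth η))) := by
    refine HasMeshLimit.of_sum_eq fun P => ?_
    rw [← LinearMap.sum_apply, ← creation_sum]
    congr 2
    calc _ = ∑ i, restr ν (P.part i) 1 (T (intervalVector ν I 0)) := by
          refine Finset.sum_congr rfl fun i _ => ?_
          rw [hpart, restr_commutes hT, restr_restr_self]
      _ = _ := by
          rw [P.sum_restr, ← restr_commutes hT, restr_intervalVector (Set.Subset.refl _)]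
  have h3 : ∀ m : Fin n, HasMeshLimit I (fun J =>
      ((q : ℝ) : ℂ) ^ (k.succAbove m : ℕ) • (inner ℂ (intervalVector ν J 0) (η (k.succAbove m)) •
        tensor q (Function.update ((k.succAbove m).removeNth η) (m.predAbove k)
          (T (intervalVector ν J 0)))
      + tensor q (Function.update (Fin.cons (restr ν J 1 (η (k.succAbove m)))
          ((k.succAbove m).removeNth η) : Fin (n + 1) → H ν) (m.predAbove k).succ
          (T (intervalVector ν J 0))))) 0 := by
    intro m
    have := ((hasMeshLimit_smul_tensor_update (q := q) I ((k.succAbove m).removeNth η)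
      (m.predAbove k) hT (c := fun J => inner ℂ (intervalVector ν J 0) (η (k.succAbove m)))
      (sq_nonneg ‖η (k.succAbove m)‖) fun J => ?_).add
      (hasMeshLimit_tensor_cons_restr (q := q) I ((k.succAbove m).removeNth η) (m.predAbove k) hT
        (η (k.succAbove m)))).const_smul (((q : ℝ) : ℂ) ^ (k.succAbove m : ℕ))
    · simpa only [add_zero, smul_zero] using this
    · rw [← norm_intervalVector_sq (ν := ν) J, ← mul_pow, mul_comm]
      exact pow_le_pow_left₀ (norm_nonneg _) (norm_inner_le_norm _ _) 2
  have h4 := ((hasMeshLimit_tensor_cons_vector (q := q) I η k hT).add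
    ((h1.add h2).const_smul (((q : ℝ) : ℂ) ^ (k : ℕ)))).add
    (HasMeshLimit.sum (s := Finset.univ) fun m _ => h3 m)
  rw [zero_add, Finset.sum_const_zero, add_zero] at h4
  refine h4.congr fun J => ?_
  rw [X_apply, field_tensor_update]
  rfl

theorem hasMeshLimit_smul_X_apply (I : Interval) (c : H ν →L[ℂ] ℂ) (v : Fock (H ν) q) :
    HasMeshLimit I (fun J => c (intervalVector ν J 0) •
      (X q ν J : Module.End ℂ (Fock (H ν) q)) v) 0 := by
  have hv : v ∈ Submodule.span ℂ {v : Fock (H ν) q | ∃ (n : ℕ) (η : Fin n → H ν), v = tensor q η} :=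
    span_tensor.ge trivial
  induction hv using Submodule.span_induction with
  | zero => simpa using HasMeshLimit.of_sum_eq (I := I) (Φ := fun _ => (0 : Fock (H ν) q)) (by simp)
  | add v w _ _ hv hw => simpa only [map_add, smul_add, add_zero] using hv.add hw
  | smul a v _ hv =>
    simpa only [map_smul, smul_comm a, smul_zero] using hv.const_smul a
  | mem v hv =>
    obtain ⟨n, η, rfl⟩ := hv
    have hc := norm_functional_sq_le c
    have h1 : HasMeshLimit I (fun J => c (intervalVector ν J 0) •
        creation (intervalVector ν J 0) (tensor q η)) 0 := by
      refine (hasMeshLimit_smul_tensor_update (q := q) I (Fin.cons 0 η : Fin (n + 1) → H ν) 0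
        id_mem_multiplierCommutant (sq_nonneg ‖c‖) hc).congr fun J => ?_
      rw [creation_tensor, Fin.update_cons_zero]
      rfl
    cases n with
    | zero =>
      refine h1.congr fun J => ?_
      rw [X_apply, Subsingleton.elim η Fin.elim0, ← vacuum, field_vacuum]
    | succ n =>
      have h2 : ∀ k : Fin (n + 1), HasMeshLimit I (fun J => (((q : ℝ) : ℂ) ^ (k : ℕ)) •
          ((c (intervalVector ν J 0) * inner ℂ (intervalVector ν J 0) (η k)) •
            tensor q (k.removeNth η)
          + c (intervalVector ν J 0) • creation (restr ν J 1 (η k)) (tensor q (k.removeNth η)))) 0 := by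
        intro k
        have h3 : HasMeshLimit I (fun J =>
            (c (intervalVector ν J 0) * inner ℂ (intervalVector ν J 0) (η k)) •
            tensor q (k.removeNth η)) 0 := by
          have := Tendsto.smul_const (hasMeshLimit_smul_inner I c (η k)) (tensor q (k.removeNth η))
          rw [zero_smul] at this
          refine this.congr fun P => ?_
          rw [Finset.sum_smul]
        have := (h3.add (hasMeshLimit_smul_creation_restr (q := q) I (k.removeNth η) (η k)
          (sq_nonneg ‖c‖) hc)).const_smul (((q : ℝ) : ℂ) ^ (k : ℕ))
        simpa only [add_zero, smul_zero] using this
      have h4 := h1.add (HasMeshLimit.sum (s := Finset.univ) fun k _ => h2 k)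
      rw [Finset.sum_const_zero, add_zero] at h4
      refine h4.congr fun J => ?_
      rw [X_apply, field, LinearMap.add_apply, LinearMap.add_apply, annihilation_tensor,
        gauge_tensor]
      simp only [smul_add, Finset.sum_add_distrib, Finset.smul_sum, smul_smul, creation_tensor,
        mul_comm (c _), mul_assoc, ContinuousLinearMap.coe_coe]
      abel

/-! ### A space of vector-valued linear maps stable under the algebra -/

variable (q ν) in
/-- The linear maps `ξ ↦ η₁ ⊗ ⋯ ⊗ T ξ ⊗ ⋯ ⊗ ηₙ` and `ξ ↦ c(ξ) v`, and their sums. -/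
def localMaps : Submodule ℂ (H ν →ₗ[ℂ] Fock (H ν) q) :=
  Submodule.span ℂ
    ({φ | ∃ (n : ℕ) (η : Fin (n + 1) → H ν) (k : Fin (n + 1)), ∃ T ∈ multiplierCommutant ν,
      φ = tensorUpdate q η k ∘ₗ T.toLinearMap} ∪
    {φ | ∃ (c : H ν →L[ℂ] ℂ) (v : Fock (H ν) q), φ = c.toLinearMap.smulRight v})

theorem tensorUpdate_mem_localMaps {n : ℕ} (η : Fin (n + 1) → H ν) (k : Fin (n + 1))
    {T : H ν →L[ℂ] H ν} (hT : T ∈ multiplierCommutant ν) :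
    tensorUpdate q η k ∘ₗ T.toLinearMap ∈ localMaps q ν :=
  Submodule.subset_span (Or.inl ⟨n, η, k, T, hT, rfl⟩)

theorem smulRight_mem_localMaps (c : H ν →L[ℂ] ℂ) (v : Fock (H ν) q) :
    c.toLinearMap.smulRight v ∈ localMaps q ν :=
  Submodule.subset_span (Or.inr ⟨c, v, rfl⟩)

theorem fieldOperator_comp_mem_localMaps (f : Poly₀) {φ : H ν →ₗ[ℂ] Fock (H ν) q}
    (hφ : φ ∈ localMaps q ν) : fieldOperator q ν f ∘ₗ φ ∈ localMaps q ν := by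
  induction hφ using Submodule.span_induction with
  | zero => rw [LinearMap.comp_zero]; exact zero_mem _
  | add φ ψ _ _ hφ hψ => rw [LinearMap.comp_add]; exact add_mem hφ hψ
  | smul c φ _ hφ => rw [LinearMap.comp_smul]; exact Submodule.smul_mem _ _ hφ
  | mem φ hφ =>
    rcases hφ with ⟨n, η, k, T, hT, rfl⟩ | ⟨c, v, rfl⟩
    · obtain ⟨S, hS, hS'⟩ := exists_operator_eq (ν := ν) f
      have h : fieldOperator q ν f ∘ₗ (tensorUpdate q η k ∘ₗ T.toLinearMap)
          = tensorUpdate q (Fin.cons (vector ν f) η : Fin (n + 2) → H ν) k.succ ∘ₗ T.toLinearMap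
          + ((q : ℝ) : ℂ) ^ (k : ℕ) •
            ((innerSL ℂ (vector ν f) ∘L T).toLinearMap.smulRight (tensor q (k.removeNth η))
            + tensorUpdate q (Fin.cons 0 (k.removeNth η) : Fin (n + 1) → H ν) 0 ∘ₗ
              (S ∘L T).toLinearMap)
          + ∑ m : Fin n, ((q : ℝ) : ℂ) ^ (k.succAbove m : ℕ) •
            (inner ℂ (vector ν f) (η (k.succAbove m)) •
                (tensorUpdate q ((k.succAbove m).removeNth η) (m.predAbove k) ∘ₗ T.toLinearMap)
              + tensorUpdate q (Fin.cons (S (η (k.succAbove m))) ((k.succAbove m).removeNth η) :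
                Fin (n + 1) → H ν) (m.predAbove k).succ ∘ₗ T.toLinearMap) := by
        ext1 x
        simp only [LinearMap.comp_apply, LinearMap.add_apply, LinearMap.smul_apply,
          LinearMap.sum_apply, tensorUpdate_apply, fieldOperator, field_tensor_update, hS',
          Fin.update_cons_zero, creation_tensor]
        rfl
      rw [h]
      refine add_mem (add_mem (tensorUpdate_mem_localMaps _ _ hT) (Submodule.smul_mem _ _
        (add_mem (smulRight_mem_localMaps _ _)
          (tensorUpdate_mem_localMaps _ _ (comp_mem_multiplierCommutant hS hT)))))
        (Submodule.sum_mem _ fun m _ => Submodule.smul_mem _ _ (add_mem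
          (Submodule.smul_mem _ _ ?_) (tensorUpdate_mem_localMaps _ _ hT)))
      cases n with
      | zero => exact m.elim0
      | succ n => exact tensorUpdate_mem_localMaps _ _ hT
    · have h : fieldOperator q ν f ∘ₗ c.toLinearMap.smulRight v
          = c.toLinearMap.smulRight (fieldOperator q ν f v) := by
        ext1 x
        simp only [LinearMap.comp_apply, LinearMap.smulRight_apply, map_smul]
      rw [h]
      exact smulRight_mem_localMaps _ _

theorem comp_mem_localMaps (U : fullAlgebra q ν) {φ : H ν →ₗ[ℂ] Fock (H ν) q}
    (hφ : φ ∈ localMaps q ν) :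
    (U : Module.End ℂ (Fock (H ν) q)) ∘ₗ φ ∈ localMaps q ν := by
  obtain ⟨U, hU⟩ := U
  dsimp only
  induction hU using Algebra.adjoin_induction generalizing φ with
  | mem T hT =>
    obtain ⟨f, rfl⟩ := hT
    exact fieldOperator_comp_mem_localMaps f hφ
  | algebraMap c => exact Submodule.smul_mem _ c hφ
  | add S T _ _ ihS ihT => exact add_mem (ihS hφ) (ihT hφ)
  | mul S T _ _ ihS ihT => exact ihS (ihT hφ)

theorem exists_hasMeshLimit (I : Interval) {φ : H ν →ₗ[ℂ] Fock (H ν) q} (hφ : φ ∈ localMaps q ν) :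
    ∃ L, HasMeshLimit I (fun J => (X q ν J : Module.End ℂ (Fock (H ν) q))
      (φ (intervalVector ν J 0))) L := by
  induction hφ using Submodule.span_induction with
  | zero => exact ⟨0, HasMeshLimit.of_sum_eq fun P => by simp⟩
  | add φ ψ _ _ hφ hψ =>
    obtain ⟨L, hL⟩ := hφ
    obtain ⟨M, hM⟩ := hψ
    exact ⟨L + M, (hL.add hM).congr fun J => by rw [LinearMap.add_apply, map_add]⟩
  | smul c φ _ hφ =>
    obtain ⟨L, hL⟩ := hφ
    exact ⟨c • L, (hL.const_smul c).congr fun J => by rw [LinearMap.smul_apply, map_smul]⟩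
  | mem φ hφ =>
    rcases hφ with ⟨n, η, k, T, hT, rfl⟩ | ⟨c, v, rfl⟩
    · exact ⟨_, hasMeshLimit_X_tensor_update I η k hT⟩
    · exact ⟨0, (hasMeshLimit_smul_X_apply I c v).congr fun J => by
        rw [LinearMap.smulRight_apply, map_smul]; rfl⟩

end Limits

section Convergence

variable {q : Set.Ioo (-1 : ℝ) 1} {ν : Measure ℝ} [IsProbabilityMeasure ν] [CompactlySupported ν]

/-! ### Convergence in `L²(φ)` -/

theorem norm_toL2 (A : fullAlgebra q ν) : ‖toL2 q ν A‖ = ‖vac q ν A‖ :=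
  UniformSpace.Completion.norm_coe A

variable (q ν) in
/-- The canonical map of the algebra into `L²(φ)` as a linear map. -/
def toL2ₗ : fullAlgebra q ν →ₗ[ℂ] L2 q ν where
  toFun := toL2 q ν
  map_add' := UniformSpace.Completion.coe_add
  map_smul' := UniformSpace.Completion.coe_smul

theorem toL2_injective : Function.Injective (toL2 q ν) := by
  change Function.Injective (toL2ₗ q ν)
  rw [injective_iff_map_eq_zero]
  intro A hA
  have h : ‖vac q ν A‖ = 0 := by rw [← norm_toL2]; exact norm_eq_zero.mpr hA
  exact vac_injective q ν (by rw [norm_eq_zero.mp h, map_zero])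

theorem tendsto_toL2 {ι : Type*} {l : Filter ι} {A : ι → fullAlgebra q ν} {B : fullAlgebra q ν}
    (h : Tendsto (fun i => vac q ν (A i)) l (𝓝 (vac q ν B))) :
    Tendsto (fun i => toL2 q ν (A i)) l (𝓝 (toL2 q ν B)) := by
  rw [tendsto_iff_norm_sub_tendsto_zero] at h ⊢
  refine h.congr fun i => ?_
  rw [← map_sub, ← norm_toL2]
  exact congrArg _ (map_sub (toL2ₗ q ν) _ _)

theorem exists_tendsto_toL2 {ι : Type*} {l : Filter ι} [l.NeBot] {A : ι → fullAlgebra q ν}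
    {v : Fock (H ν) q} (h : Tendsto (fun i => vac q ν (A i)) l (𝓝 v)) :
    ∃ L, Tendsto (fun i => toL2 q ν (A i)) l (𝓝 L) := by
  have hi : Isometry (vac q ν) := AddMonoidHomClass.isometry_of_norm _ norm_vac
  have h1 : Cauchy (map A l) := by
    rw [← hi.isUniformInducing.cauchy_map_iff, Filter.map_map]
    exact h.cauchy_map
  have h2 := h1.map (UniformSpace.Completion.uniformContinuous_coe (fullAlgebra q ν))
  rw [Filter.map_map] at h2
  exact CompleteSpace.complete h2

/-! ### The fields of the process -/

theorem Y_apply (k : ℕ) (J : Interval) (v : Fock (H ν) q) :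
    (Y q ν (k + 1) J : Module.End ℂ (Fock (H ν) q)) v
      = field (intervalVector ν J k) (restr ν J (k + 1)).toLinearMap v := by
  change fieldOperator q ν _ v = _
  rw [fieldOperator, operator_powWord J (Nat.succ_pos k), vector_powWord J k]

theorem vac_X (J : Interval) :
    vac q ν (X q ν J) = creation (intervalVector ν J 0) (vacuum (H ν) q) := by
  change (X q ν J : Module.End ℂ (Fock (H ν) q)) (vacuum (H ν) q) = _
  rw [X_apply, field_vacuum]

theorem vac_sandwichSum {I : Interval} (U : fullAlgebra q ν) (P : Subdivision I) :
    vac q ν (sandwichSum q ν U P) = ∑ i, (X q ν (P.part i) : Module.End ℂ (Fock (H ν) q))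
      ((U : Module.End ℂ (Fock (H ν) q))
        (creation (intervalVector ν (P.part i) 0) (vacuum (H ν) q))) := by
  rw [sandwichSum, map_sum]
  refine Finset.sum_congr rfl fun i _ => ?_
  rw [mul_assoc, vac_mul, vac_mul, vac_X]

theorem exists_hasSandwichIntegral (I : Interval) (U : fullAlgebra q ν) :
    ∃ L, HasSandwichIntegral q ν I U L := by
  obtain ⟨L, hL⟩ := exists_hasMeshLimit I (comp_mem_localMaps U
    (tensorUpdate_mem_localMaps (q := q) (fun _ : Fin 1 => (0 : H ν)) 0 id_mem_multiplierCommutant))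
  refine exists_tendsto_toL2 (v := L) (hL.congr' (Eventually.of_forall fun P => ?_))
  refine Eq.trans (Finset.sum_congr rfl fun i _ => ?_) (vac_sandwichSum U P).symm
  dsimp only
  rw [vacuum, creation_tensor, LinearMap.comp_apply, LinearMap.comp_apply, tensorUpdate_apply]
  congr 3
  funext j
  rw [Fin.fin_one_eq_zero j]
  simp

/-! ### Adapted elements -/

theorem restr_self_intervalVector (J : Interval) (k : ℕ) :
    restr ν J 0 (intervalVector ν J k) = intervalVector ν J k := by
  rw [restr_intervalVector (Set.Subset.refl _), zero_add]

theorem adapted_rightCreation {t : ℝ≥0} {U : fullAlgebra q ν} (hU : U ∈ algebraUpTo q ν t)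
    {J : Interval} (hJ : t ≤ J.lo) (v : Fock (H ν) q) :
    (U : Module.End ℂ (Fock (H ν) q)) (rightCreation (intervalVector ν J 0) v)
      = rightCreation (intervalVector ν J 0) ((U : Module.End ℂ (Fock (H ν) q)) v) := by
  induction hU using Algebra.adjoin_induction generalizing v with
  | mem A hA =>
    obtain ⟨k, hk, s, hs, rfl⟩ := hA
    obtain ⟨k, rfl⟩ := Nat.exists_eq_add_of_le' hk
    have hd : Disjoint (Interval.upTo s).toSet J.toSet := disjoint_upTo (hs.trans hJ)
    rw [Y_apply, field_rightCreation, Y_apply]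
    have h1 : inner ℂ (intervalVector ν (.upTo s) k) (intervalVector ν J 0) = 0 := by
      rw [← restr_self_intervalVector, ← restr_self_intervalVector J,
        inner_restr_restr_of_disjoint hd]
    have h2 : (restr ν (.upTo s) (k + 1)).toLinearMap (intervalVector ν J 0) = 0 := by
      rw [← restr_self_intervalVector J]
      exact restr_restr_of_disjoint hd _ _ _
    rw [h1, h2, zero_smul, ← creationₗ_apply, map_zero, LinearMap.zero_apply, add_zero, add_zero]
  | algebraMap c => exact (map_smul (rightCreation (intervalVector ν J 0)) c v).symm
  | add A B _ _ hA hB =>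
    change (A : Module.End ℂ (Fock (H ν) q)) _ + (B : Module.End ℂ (Fock (H ν) q)) _ = _
    rw [hA, hB, ← map_add]
    rfl
  | mul A B _ _ hA hB =>
    change (A : Module.End ℂ (Fock (H ν) q)) ((B : Module.End ℂ (Fock (H ν) q)) _) = _
    rw [hB, hA]
    rfl

variable (q ν) in
/-- The span of the tensors of vectors supported in `[0, t)`. -/
def pastFock (t : ℝ≥0) : Submodule ℂ (Fock (H ν) q) :=
  Submodule.span ℂ {v | ∃ (n : ℕ) (η : Fin n → H ν),
    (∀ i, restr ν (.upTo t) 0 (η i) = η i) ∧ v = tensor q η}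

theorem tensor_mem_pastFock {t : ℝ≥0} {n : ℕ} {η : Fin n → H ν}
    (hη : ∀ i, restr ν (.upTo t) 0 (η i) = η i) : tensor q η ∈ pastFock q ν t :=
  Submodule.subset_span ⟨n, η, hη, rfl⟩

theorem field_mem_pastFock {t : ℝ≥0} {ζ : H ν} {T : H ν →ₗ[ℂ] H ν}
    (hζ : restr ν (.upTo t) 0 ζ = ζ)
    (hT : ∀ f, restr ν (.upTo t) 0 (T f) = T (restr ν (.upTo t) 0 f)) {v : Fock (H ν) q}
    (hv : v ∈ pastFock q ν t) : field ζ T v ∈ pastFock q ν t := by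
  induction hv using Submodule.span_induction with
  | zero => rw [map_zero]; exact zero_mem _
  | add v w _ _ hv hw => rw [map_add]; exact add_mem hv hw
  | smul c v _ hv => rw [map_smul]; exact Submodule.smul_mem _ _ hv
  | mem v hv =>
    obtain ⟨n, η, hη, rfl⟩ := hv
    have h1 : creation ζ (tensor q η) ∈ pastFock q ν t := by
      rw [creation_tensor]
      exact tensor_mem_pastFock (Fin.cases hζ hη)
    cases n with
    | zero => rwa [Subsingleton.elim η Fin.elim0, ← vacuum, field_vacuum, vacuum,
        ← Subsingleton.elim η Fin.elim0]
    | succ n =>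
      rw [field, LinearMap.add_apply, LinearMap.add_apply, annihilation_tensor, gauge_tensor]
      refine add_mem (add_mem (Submodule.sum_mem _ fun k _ => Submodule.smul_mem _ _
        (tensor_mem_pastFock fun i => hη _)) h1) (Submodule.sum_mem _ fun k _ =>
          Submodule.smul_mem _ _ (tensor_mem_pastFock (Fin.cases ?_ fun i => hη _)))
      rw [Fin.cons_zero, hT, hη]

theorem adapted_mem_pastFock {t : ℝ≥0} {U : fullAlgebra q ν} (hU : U ∈ algebraUpTo q ν t)
    {v : Fock (H ν) q} (hv : v ∈ pastFock q ν t) :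
    (U : Module.End ℂ (Fock (H ν) q)) v ∈ pastFock q ν t := by
  induction hU using Algebra.adjoin_induction generalizing v with
  | mem A hA =>
    obtain ⟨k, hk, s, hs, rfl⟩ := hA
    obtain ⟨k, rfl⟩ := Nat.exists_eq_add_of_le' hk
    rw [Y_apply]
    refine field_mem_pastFock ?_ (fun f => mulOp_comm _ _ _ _ _) hv
    have hsub : (Interval.upTo s).toSet ⊆ (Interval.upTo t).toSet :=
      Set.Ico_subset_Ico_right (NNReal.coe_le_coe.mpr hs)
    rw [← restr_self_intervalVector (.upTo s), restr, restr, mulOp_mulOp,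
      mulOp_congr _ (Set.inter_eq_right.mpr hsub) (zero_add 0)]
  | algebraMap c => exact Submodule.smul_mem _ c hv
  | add A B _ _ hA hB => exact add_mem (hA hv) (hB hv)
  | mul A B _ _ hA hB => exact hA (hB hv)

theorem qPowNumber_mem_pastFock {t : ℝ≥0} {v : Fock (H ν) q} (hv : v ∈ pastFock q ν t) :
    qPowNumber (H ν) q v ∈ pastFock q ν t := by
  induction hv using Submodule.span_induction with
  | zero => rw [map_zero]; exact zero_mem _
  | add v w _ _ hv hw => rw [map_add]; exact add_mem hv hw
  | smul c v _ hv => rw [map_smul]; exact Submodule.smul_mem _ _ hv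
  | mem v hv =>
    obtain ⟨n, η, hη, rfl⟩ := hv
    rw [qPowNumber_tensor]
    exact Submodule.smul_mem _ _ (tensor_mem_pastFock hη)

/-- On the past, a field over a later interval acts as a creation operator. -/
theorem field_eq_creation_of_mem_pastFock {t : ℝ≥0} {I : Interval} (hI : t ≤ I.lo) (k l : ℕ)
    {v : Fock (H ν) q} (hv : v ∈ pastFock q ν t) :
    field (intervalVector ν I k) (restr ν I l).toLinearMap v
      = creation (intervalVector ν I k) v := by
  induction hv using Submodule.span_induction with
  | zero => rw [map_zero, map_zero]
  | add v w _ _ hv hw => rw [map_add, map_add, hv, hw]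
  | smul c v _ hv => rw [map_smul, map_smul, hv]
  | mem v hv =>
    obtain ⟨n, η, hη, rfl⟩ := hv
    cases n with
    | zero => rw [Subsingleton.elim η Fin.elim0, ← vacuum, field_vacuum]
    | succ n =>
      have hd := disjoint_upTo hI
      have h1 : ∀ i, inner ℂ (intervalVector ν I k) (η i) = 0 := fun i => by
        rw [← restr_self_intervalVector, ← hη i, inner_restr_restr_of_disjoint hd.symm]
      have h2 : ∀ i, (restr ν I l).toLinearMap (η i) = 0 := fun i => by
        rw [← hη i]
        exact restr_restr_of_disjoint hd.symm _ _ _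
      rw [field, LinearMap.add_apply, LinearMap.add_apply, annihilation_tensor, gauge_tensor]
      simp only [h1, h2, ← creation_tensor]
      simp [← creationₗ_apply]

/-! ### The diagonal measure -/

theorem hasMeshLimit_X_rightCreation (I : Interval) (v : Fock (H ν) q) :
    HasMeshLimit I (fun J => (X q ν J : Module.End ℂ (Fock (H ν) q))
        (rightCreation (intervalVector ν J 0) v))
      ((I.length : ℂ) • qPowNumber (H ν) q v
        + creation (intervalVector ν I 1) (qPowNumber (H ν) q v)) := by
  have hv : v ∈ Submodule.span ℂ {v : Fock (H ν) q | ∃ (n : ℕ) (η : Fin n → H ν), v = tensor q η} :=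
    span_tensor.ge trivial
  induction hv using Submodule.span_induction with
  | zero => exact HasMeshLimit.of_sum_eq (by simp)
  | add v w _ _ hv hw =>
    have := (hv.add hw).congr fun J => by rw [← map_add, ← map_add]
    rwa [add_add_add_comm, ← smul_add, ← map_add, ← map_add, ← map_add] at this
  | smul c v _ hv =>
    have := (hv.const_smul c).congr fun J => by rw [← map_smul, ← map_smul]
    rw [map_smul, map_smul, smul_comm, ← smul_add]
    exact this
  | mem v hv =>
    obtain ⟨n, η, rfl⟩ := hv
    have := hasMeshLimit_X_tensor_update (q := q) I (Fin.snoc η 0 : Fin (n + 1) → H ν) (Fin.last n)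
      id_mem_multiplierCommutant
    simp only [ContinuousLinearMap.id_apply, Fin.removeNth_last, Fin.init_snoc, Fin.val_last,
      inner_intervalVector, Fin.update_snoc_last, ← rightCreation_tensor] at this
    rwa [smul_add, smul_comm, ← map_smul, ← qPowNumber_tensor] at this

variable (q ν) in
/-- The diagonal measure `Δ₂(t) = t + Y₂(t)`. -/
def diagonalTwo (t : ℝ≥0) : fullAlgebra q ν := ((t : ℝ) : ℂ) • 1 + Y q ν 2 (.upTo t)

theorem tendsto_sum_X_sq (t : ℝ≥0) :
    Tendsto (fun P : Subdivision (.upTo t) => toL2 q ν (∑ i, X q ν (P.part i) ^ 2))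
      (meshFilter (.upTo t)) (𝓝 (toL2 q ν (diagonalTwo q ν t))) := by
  refine tendsto_toL2 ?_
  have h := hasMeshLimit_X_rightCreation (q := q) (ν := ν) (.upTo t) (vacuum (H ν) q)
  have h1 : vac q ν (diagonalTwo q ν t) = ((Interval.upTo t).length : ℂ) •
      qPowNumber (H ν) q (vacuum (H ν) q) + creation (intervalVector ν (.upTo t) 1)
        (qPowNumber (H ν) q (vacuum (H ν) q)) := by
    have h2 : qPowNumber (H ν) q (vacuum (H ν) q) = vacuum (H ν) q := by
      rw [vacuum, qPowNumber_tensor, pow_zero, one_smul]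
    have h3 : (Interval.upTo t).length = (t : ℝ) := by simp [Interval.length, Interval.upTo]
    rw [h2, h3, diagonalTwo, map_add, map_smul, vac_one]
    congr 1
    exact (Y_apply 1 _ _).trans (field_vacuum _ _)
  rw [h1]
  refine Tendsto.congr (fun P => ?_) h
  rw [map_sum]
  refine Finset.sum_congr rfl fun i _ => ?_
  dsimp only
  rw [pow_two, vac_mul, vac_X, rightCreation_vacuum]

variable (q ν) in
theorem isDiagonalMeasure_diagonalTwo : IsDiagonalMeasure q ν 2 (diagonalTwo q ν) :=
  tendsto_sum_X_sq

theorem IsDiagonalMeasure.unique {k : ℕ} {Δ Δ' : ℝ≥0 → fullAlgebra q ν}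
    (h : IsDiagonalMeasure q ν k Δ) (h' : IsDiagonalMeasure q ν k Δ') : Δ = Δ' :=
  funext fun t => toL2_injective (tendsto_nhds_unique (h t) (h' t))

theorem intervalVector_upTo_hi (I : Interval) (k : ℕ) :
    intervalVector ν (.upTo I.hi) k = intervalVector ν (.upTo I.lo) k + intervalVector ν I k := by
  have h1 : (Interval.upTo I.lo).toSet ⊆ (Interval.upTo I.hi).toSet :=
    Set.Ico_subset_Ico_right (NNReal.coe_le_coe.mpr I.le)
  have h2 : I.toSet ⊆ (Interval.upTo I.hi).toSet := Set.Ico_subset_Ico_left I.lo.2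
  have h := restr_upTo_hi I 0 (intervalVector ν (.upTo I.hi) k)
  rwa [restr_self_intervalVector, restr_intervalVector h1, restr_intervalVector h2, zero_add] at h

/-- The increments of the diagonal measure on the past. -/
theorem diagonalTwo_sub_apply (I : Interval) {v : Fock (H ν) q} (hv : v ∈ pastFock q ν I.lo) :
    ((diagonalTwo q ν I.hi - diagonalTwo q ν I.lo : fullAlgebra q ν) :
        Module.End ℂ (Fock (H ν) q)) v
      = (I.length : ℂ) • v + creation (intervalVector ν I 1) v := by
  have h1 : (restr ν (.upTo I.hi) 2).toLinearMap
      = (restr ν (.upTo I.lo) 2).toLinearMap + (restr ν I 2).toLinearMap :=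
    LinearMap.ext fun f => restr_upTo_hi I 2 f
  have h2 : (Y q ν 2 (.upTo I.hi) : Module.End ℂ (Fock (H ν) q)) v
      = (Y q ν 2 (.upTo I.lo) : Module.End ℂ (Fock (H ν) q)) v
        + creation (intervalVector ν I 1) v := by
    rw [Y_apply 1, Y_apply 1, h1, intervalVector_upTo_hi, field_add, LinearMap.add_apply,
      field_eq_creation_of_mem_pastFock le_rfl _ _ hv]
  change (((I.hi : ℝ) : ℂ) • v + (Y q ν 2 (.upTo I.hi) : Module.End ℂ (Fock (H ν) q)) v)
    - (((I.lo : ℝ) : ℂ) • v + (Y q ν 2 (.upTo I.lo) : Module.End ℂ (Fock (H ν) q)) v) = _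
  rw [h2, Interval.length, Complex.ofReal_sub, sub_smul]
  abel

/-! ### The integrals of adapted processes -/

theorem hasSandwichIntegral_of_adapted {Γ : fullAlgebra q ν →ₗ[ℂ] fullAlgebra q ν}
    (hΓ : IsSecondQuantization q ν Γ) (I : Interval) {U : fullAlgebra q ν}
    (hU : U ∈ algebraUpTo q ν I.lo) :
    HasSandwichIntegral q ν I U
      (toL2 q ν ((diagonalTwo q ν I.hi - diagonalTwo q ν I.lo) * Γ U)) := by
  refine tendsto_toL2 ?_
  have h1 : vac q ν U ∈ pastFock q ν I.lo :=
    adapted_mem_pastFock hU (tensor_mem_pastFock fun i => i.elim0)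
  rw [vac_mul, hΓ.vac_apply, diagonalTwo_sub_apply I (qPowNumber_mem_pastFock h1)]
  refine Tendsto.congr (fun P => ?_) (hasMeshLimit_X_rightCreation I (vac q ν U))
  rw [vac_sandwichSum]
  refine Finset.sum_congr rfl fun i _ => ?_
  rw [← rightCreation_vacuum, adapted_rightCreation hU (P.lo_le_part i)]
  rfl

/-- The processes `χ_{[0, t)} U` with `t > 0` are linearly independent over different `t`. -/
theorem exists_linearMap_indicator {A B : Type*} [AddCommGroup A] [Module ℂ A] [AddCommGroup B]
    [Module ℂ B] (G : ℝ≥0 → A →ₗ[ℂ] B) (hG : G 0 = 0) :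
    ∃ M : (ℝ≥0 → A) →ₗ[ℂ] B, ∀ (t : ℝ≥0) (U : A), M ((Set.Iio t).indicator fun _ => U) = G t U := by
  classical
  let Ξ : (Set.Ioi (0 : ℝ≥0) →₀ A) →ₗ[ℂ] (ℝ≥0 → A) := Finsupp.lsum ℂ fun t =>
    LinearMap.pi fun x => if x < (t : ℝ≥0) then LinearMap.id else 0
  have hΞ : ∀ g x, Ξ g x = ∑ t ∈ g.support, if x < (t : ℝ≥0) then g t else 0 := by
    intro g x
    simp only [Ξ, Finsupp.lsum_apply, Finsupp.sum, Finset.sum_apply, LinearMap.pi_apply]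
    refine Finset.sum_congr rfl fun t _ => ?_
    split_ifs <;> rfl
  have hinj : LinearMap.ker Ξ = ⊥ := by
    rw [LinearMap.ker_eq_bot']
    intro g hg
    by_contra hne
    obtain ⟨t, ht, hmax⟩ := g.support.exists_max_image id (Finsupp.support_nonempty_iff.mpr hne)
    let x : ℝ≥0 := (g.support.erase t).sup Subtype.val
    have hx : x < t := by
      refine (Finset.sup_lt_iff (show (⊥ : ℝ≥0) < t from t.2)).mpr fun s hs => ?_
      exact lt_of_le_of_ne (hmax s (Finset.mem_of_mem_erase hs))
        fun h => Finset.ne_of_mem_erase hs (Subtype.ext h)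
    have h1 := congrFun hg x
    rw [hΞ, Finset.sum_eq_single_of_mem t ht, if_pos hx] at h1
    · exact Finsupp.mem_support_iff.mp ht h1
    · intro s hs hst
      exact if_neg (not_lt.mpr (Finset.le_sup (f := Subtype.val) (Finset.mem_erase.mpr ⟨hst, hs⟩)))
  obtain ⟨ρ, hρ⟩ := LinearMap.exists_leftInverse_of_injective Ξ hinj
  refine ⟨Finsupp.lsum ℂ (fun t : Set.Ioi (0 : ℝ≥0) => G t) ∘ₗ ρ, fun t U => ?_⟩
  rcases eq_or_lt_of_le (zero_le (a := t)) with rfl | ht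
  · have : (Set.Iio (0 : ℝ≥0)).indicator (fun _ => U) = 0 := by
      funext x; simp
    rw [this, map_zero, hG, LinearMap.zero_apply]
  · have h1 : (Set.Iio t).indicator (fun _ => U) = Ξ (Finsupp.single ⟨t, ht⟩ U) := by
      funext x
      simp only [Ξ, Finsupp.lsum_single, LinearMap.pi_apply, Set.indicator_apply, Set.mem_Iio]
      split_ifs <;> rfl
    rw [h1, LinearMap.comp_apply, ← LinearMap.comp_apply ρ, hρ, LinearMap.id_apply,
      Finsupp.lsum_single]

theorem elementary_eq_sub (I : Interval) (U : fullAlgebra q ν) :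
    elementary q ν I U
      = (Set.Iio I.hi).indicator (fun _ => U) - (Set.Iio I.lo).indicator fun _ => U := by
  funext t
  simp only [elementary, Pi.sub_apply, Set.indicator_apply, Set.mem_Ico, Set.mem_Iio]
  rcases lt_or_ge t I.lo with h | h
  · simp [h, h.trans_le I.le]
  · simp [h, not_lt.mpr h]

variable (q ν) in
theorem exists_isSandwichIntegral :
    ∃ J : simpleAdapted q ν →ₗ[ℂ] L2 q ν, IsSandwichIntegral q ν J := by
  obtain ⟨Γ, hΓ, -⟩ := existsUnique_isSecondQuantization q ν
  obtain ⟨M, hM⟩ := exists_linearMap_indicator (fun t => toL2ₗ q ν ∘ₗ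
    LinearMap.mulLeft ℂ (diagonalTwo q ν t - diagonalTwo q ν 0) ∘ₗ Γ) (by
      ext1 A
      simp)
  refine ⟨M ∘ₗ (simpleAdapted q ν).subtype, fun I U hU => ?_⟩
  have h : (M ∘ₗ (simpleAdapted q ν).subtype) ⟨elementary q ν I U, elementary_mem q ν hU⟩
      = toL2 q ν ((diagonalTwo q ν I.hi - diagonalTwo q ν I.lo) * Γ U) := by
    refine (congrArg M (elementary_eq_sub I U)).trans ?_
    rw [map_sub, hM, hM]
    simp only [LinearMap.comp_apply, LinearMap.mulLeft_apply]
    rw [← map_sub, ← sub_mul, sub_sub_sub_cancel_right]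
    rfl
  rw [h]
  exact hasSandwichIntegral_of_adapted hΓ I hU

theorem IsSandwichIntegral.unique {J J' : simpleAdapted q ν →ₗ[ℂ] L2 q ν}
    (h : IsSandwichIntegral q ν J) (h' : IsSandwichIntegral q ν J') : J = J' := by
  refine LinearMap.ext fun ⟨V, hV⟩ => ?_
  induction hV using Submodule.span_induction with
  | mem V hV =>
    obtain ⟨I, U, hU, rfl⟩ := hV
    exact tendsto_nhds_unique (h I U hU) (h' I U hU)
  | zero => exact (map_zero J).trans (map_zero J').symm
  | add V W hV hW ihV ihW =>
    have := congrArg₂ (· + ·) ihV ihW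
    rwa [← map_add, ← map_add] at this
  | smul c V hV ih =>
    have := congrArg (c • ·) ih
    simp only [← map_smul] at this
    exact this

end Convergence

end QLevy

end

theorem mainTheorem11 (q : Set.Ioo (-1 : ℝ) 1) (ν : MeasureTheory.Measure ℝ)
    [MeasureTheory.IsProbabilityMeasure ν] [QLevy.CompactlySupported ν] :
    (∀ (I : QLevy.Interval) (U : QLevy.fullAlgebra q ν),
      ∃ L : QLevy.L2 q ν, QLevy.HasSandwichIntegral q ν I U L) ∧
    (∃! J : QLevy.simpleAdapted q ν →ₗ[ℂ] QLevy.L2 q ν, QLevy.IsSandwichIntegral q ν J) ∧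
    (∃! Δ : NNReal → QLevy.fullAlgebra q ν, QLevy.IsDiagonalMeasure q ν 2 Δ) ∧
    (∃! Γ : QLevy.fullAlgebra q ν →ₗ[ℂ] QLevy.fullAlgebra q ν,
      QLevy.IsSecondQuantization q ν Γ) ∧
    ∀ (J : QLevy.simpleAdapted q ν →ₗ[ℂ] QLevy.L2 q ν) (Δ : NNReal → QLevy.fullAlgebra q ν)
      (Γ : QLevy.fullAlgebra q ν →ₗ[ℂ] QLevy.fullAlgebra q ν),
      QLevy.IsSandwichIntegral q ν J → QLevy.IsDiagonalMeasure q ν 2 Δ →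
      QLevy.IsSecondQuantization q ν Γ →
      ∀ (n : ℕ) (I : Fin n → QLevy.Interval) (U : Fin n → QLevy.fullAlgebra q ν)
        (hU : ∀ i, U i ∈ QLevy.algebraUpTo q ν (I i).lo),
        J (∑ i, ⟨QLevy.elementary q ν (I i) (U i), QLevy.elementary_mem q ν (hU i)⟩) =
          QLevy.toL2 q ν (QLevy.leftIntegral q ν Δ I fun i => Γ (U i)) := by

  refine ⟨QLevy.exists_hasSandwichIntegral, ?_, ?_, QLevy.existsUnique_isSecondQuantization q ν, ?_⟩
  · obtain ⟨J, hJ⟩ := QLevy.exists_isSandwichIntegral q ν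
    exact ⟨J, hJ, fun J' hJ' => hJ'.unique hJ⟩
  · exact ⟨_, QLevy.isDiagonalMeasure_diagonalTwo q ν,
      fun Δ hΔ => hΔ.unique (QLevy.isDiagonalMeasure_diagonalTwo q ν)⟩
  · intro J Δ Γ hJ hΔ hΓ n I U hU
    obtain rfl := hΔ.unique (QLevy.isDiagonalMeasure_diagonalTwo q ν)
    have h := map_sum (QLevy.toL2ₗ q ν) (fun i => (QLevy.diagonalTwo q ν (I i).hi
      - QLevy.diagonalTwo q ν (I i).lo) * Γ (U i)) Finset.univ
    rw [map_sum]
    refine Eq.trans (Finset.sum_congr rfl fun i _ => ?_) h.symm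
    exact tendsto_nhds_unique (hJ (I i) (U i) (hU i))
      (QLevy.hasSandwichIntegral_of_adapted hΓ (I i) (hU i))
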